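/- Let $\mathcal X$ be a finite alphabet with $|\mathcal X|=n\ge 3$, let $X$ be uniform on $\mathcal X$, and let $Y$ be the output, on input $X$, of the Hamming channel $\mathcal H_{n,\alpha}$ on $\mathcal X$, where $$\mathcal H_{n,\alpha}(y\mid x)=\begin{cases}1-(n-1)\alpha,& x=y,\\ \alpha,& x\ne y,\end{cases}\qquad \alpha\in\left(0,\tfrac1n\right)\cup\left(\tfrac1n,\tfrac1{n-1}\right).$$ For $R\in[0,\log n]$, a channel $p_{T|X}$ into a finite alphabet $\mathcal T$ is called an IB maximizer at $R$ if $I(X;T)\le R$ and $I(Y;T)$ is maximal among all channels from $\mathcal X$ to a finite alphabet satisfying this constraint, where $Y-X-T$ is a Markov chain. It is called minimal if no IB maximizer at $R$ has a smaller alphabet. For $q\in[0,\frac1{n-1}]$ let $h_n(q)=-(1-(n-1)q)\log(1-(n-1)q)-(n-1)q\log q$, and let $h_n^{-1}:[0,\log n]\to[0,\frac1n]$ be the inverse of the restriction of $h_n$ to $[0,\frac1n]$. For $R\in[0,\log n]$ let $$\varphi(R)=\max\{\log n-H(Y') : \log n-H(X')\le R\},$$ where $X'$ ranges over all random variables on $\mathcal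 X$ and $Y'$ is the output of $\mathcal H_{n,\alpha}$ on input $X'$. Let $\widehat\varphi$ be the upper concave envelope of $\varphi$ on $[0,\log n]$. **Theorem.** The minimum $R_c=\min\{R\in(0,\log n] : \varphi(R)=\widehat\varphi(R)\}$ exists and $0<R_c<\log n$. For $R\in[0,\log n]$, the minimal IB maximizers $p_{T|X}:\mathcal X\to\mathcal T$ at $R$ are, up to relabelling $\mathcal T$, exactly the following. - If $R=0$: $|\mathcal T|=1$, i.e. $T$ is constant. - If $R\in(0,R_c)$: $|\mathcal T|=n+1$, $\mathcal T=\{t_0\}\sqcup\mathcal X$, and $p_{T|X}$ is the time sharing of the constant symbol $t_0$, with probability $1-\frac R{R_c}$, and the Hamming channel $\mathcal H_{n,\beta_c}$, with probability $\frac R{R_c}$, where $\beta_c=h_n^{-1}(\log n-R_c)$. That is, $p_{T|X}(t_0\mid x)=1-\frac R{R_c}$ and $p_{T|X}(x'\mid x)=\frac R{R_c}\mathcal H_{n,\beta_c}(x'\mid x)$. - If $R\in[R_c,\log n]$: $|\mathcal T|=n$, $\mathcal T=\mathcal X$, and $p_{T|X}=\mathcal H_{n,\beta}$ with $\beta=h_n^{-1}(\log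 n-R)$. -/

import Mathlib

open scoped BigOperators

noncomputable section

namespace IB

/-- `W x y` is the probability of the output `y` given the input `x`: every row of a channel is
a probability vector. -/
def IsChannel {A B : Type*} [Fintype B] (W : A → B → ℝ) : Prop :=
  ∀ x, W x ∈ stdSimplex ℝ B

/-- Shannon entropy (in nats) of a finite distribution, with the convention `0 log 0 = 0`. -/
def entropy {A : Type*} [Fintype A] (p : A → ℝ) : ℝ :=
  ∑ a, Real.negMulLog (p a)

/-- Mutual information `H(A) + H(B) - H(A, B)` of a joint distribution `J`. -/
def mutualInfo {A B : Type*} [Fintype A] [Fintype B] (J : A → B → ℝ) : ℝ :=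
  entropy (fun a => ∑ b, J a b) + entropy (fun b => ∑ a, J a b)
    - entropy (fun ab : A × B => J ab.1 ab.2)

/-- The distribution of the output of the channel `W` when the input has distribution `p`. -/
def outputDist {A B : Type*} [Fintype A] (p : A → ℝ) (W : A → B → ℝ) : B → ℝ :=
  fun y => ∑ x, p x * W x y

/-- `I(X;T)` for `X ∼ p` and `p_{T|X} = q`. -/
def infoXT {A T : Type*} [Fintype A] [Fintype T] (p : A → ℝ) (q : A → T → ℝ) : ℝ :=
  mutualInfo (fun x t => p x * q x t)

/-- `I(Y;T)` for `X ∼ p`, `p_{Y|X} = W`, `p_{T|X} = q` and the Markov chain `Y - X - T`. -/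
def infoYT {A B T : Type*} [Fintype A] [Fintype B] [Fintype T]
    (p : A → ℝ) (W : A → B → ℝ) (q : A → T → ℝ) : ℝ :=
  mutualInfo (fun y t => ∑ x, p x * W x y * q x t)

/-- The channel `q = p_{T|X}` is feasible at rate `R`: `I(X;T) ≤ R`. -/
def IsFeasible {A T : Type*} [Fintype A] [Fintype T] (p : A → ℝ) (R : ℝ) (q : A → T → ℝ) :
    Prop :=
  IsChannel q ∧ infoXT p q ≤ R

/-- `q = p_{T|X}` attains the maximum of `I(Y;T)` over all representations, over any finite
alphabet, with `I(X;T) ≤ R`. (Any finite alphabet is in bijection with some `Fin m`.) -/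
def IsMaximizer {A B T : Type*} [Fintype A] [Fintype B] [Fintype T]
    (p : A → ℝ) (W : A → B → ℝ) (R : ℝ) (q : A → T → ℝ) : Prop :=
  IsFeasible p R q ∧
    ∀ (m : ℕ) (q' : A → Fin m → ℝ), IsFeasible p R q' → infoYT p W q' ≤ infoYT p W q

/-- A maximizer such that no maximizer has a smaller alphabet. -/
def IsMinimalMaximizer {A B T : Type*} [Fintype A] [Fintype B] [Fintype T]
    (p : A → ℝ) (W : A → B → ℝ) (R : ℝ) (q : A → T → ℝ) : Prop :=
  IsMaximizer p W R q ∧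
    ∀ (m : ℕ) (q' : A → Fin m → ℝ), IsMaximizer p W R q' → Fintype.card T ≤ m

/-- The uniform distribution on a finite alphabet. -/
def uniform (A : Type*) [Fintype A] : A → ℝ :=
  fun _ => 1 / (Fintype.card A : ℝ)

/-- The Hamming channel with crossover probability `α` on the alphabet `A`. -/
def hamming (A : Type*) [Fintype A] [DecidableEq A] (α : ℝ) : A → A → ℝ :=
  fun x y => if x = y then 1 - ((Fintype.card A : ℝ) - 1) * α else α

/-- The entropy `h_n(q)` of `(1 - (n-1)q, q, …, q)`. -/
def hEnt (n : ℕ) (q : ℝ) : ℝ :=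
  -(1 - ((n : ℝ) - 1) * q) * Real.log (1 - ((n : ℝ) - 1) * q) - ((n : ℝ) - 1) * q * Real.log q

/-- The inverse `h_n⁻¹ : [0, log n] → [0, 1/n]` of the restriction of `h_n` to `[0, 1/n]`. -/
def hInv (n : ℕ) : ℝ → ℝ :=
  Function.invFunOn (hEnt n) (Set.Icc 0 (1 / (n : ℝ)))

/-- `φ(R)`: the maximum of `log n - H(Y)` over input distributions with `log n - H(X) ≤ R`,
where `Y` is the output of the channel `W` on input `X` and `n` is the alphabet size. -/
def phi {A : Type*} [Fintype A] (W : A → A → ℝ) (R : ℝ) : ℝ :=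
  sSup {v | ∃ p ∈ stdSimplex ℝ A, Real.log (Fintype.card A) - entropy p ≤ R ∧
    v = Real.log (Fintype.card A) - entropy (outputDist p W)}

/-- Upper concave envelope of `f` on `s`: pointwise infimum of the concave majorants. -/
def upperConcaveEnvelope (s : Set ℝ) (f : ℝ → ℝ) (r : ℝ) : ℝ :=
  sInf {v | ∃ g : ℝ → ℝ, ConcaveOn ℝ s g ∧ (∀ u ∈ s, f u ≤ g u) ∧ v = g r}

/-- The set of `R ∈ (0, log n]` at which `φ` touches its upper concave envelope on `[0, log n]`;
`R_c` is its least element. -/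
def touchingSet {A : Type*} [Fintype A] (W : A → A → ℝ) : Set ℝ :=
  {R | 0 < R ∧ R ≤ Real.log (Fintype.card A) ∧
    phi W R = upperConcaveEnvelope (Set.Icc 0 (Real.log (Fintype.card A))) (phi W) R}

/-- Time sharing: with probability `1 - s` output the constant symbol `none`, and with
probability `s` the output of the channel `V`. -/
def timeShare {A : Type*} (s : ℝ) (V : A → A → ℝ) : A → Option A → ℝ
  | _, none => 1 - s
  | x, some x' => s * V x x'

/-- `q` is the channel `V` up to a relabelling of the output alphabet. -/
def IsRelabelling {A T S : Type*} (q : A → T → ℝ) (V : A → S → ℝ) : Prop :=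
  ∃ e : T ≃ S, ∀ x t, q x t = V x (e t)

end IB

end

namespace IB

open Set Filter Topology

/-! Write D(p) = log n − H(p) (`deficit`) and let W be the Hamming channel. The uniform law is
stationary under W, so conditioning on T = t gives I(X;T) = Σ P(t) D(p_t) and I(Y;T) = Σ P(t) D(W
p_t), where p_t is the posterior of X. The question concerns the upper boundary of the convex hull
of the points (D(p), D(Wp)); supporting lines give both the optimal value and the equality cases,
and the bound is attained because the rows of a Hamming matrix average to the uniform law.

A supporting line of slope μ maximizes D(Wp) − μ D(p). Since W acts on every coordinate by the same
affine map, this is a constant plus Σ F(p_k) with F concave, then convex; exchanging mass between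
two coordinates shows that maximizers are Hamming rows (`exists_eq_hamming_of_isMaxOn_sum`). What
remains is a plane curve parametrized by the crossover b in [0, 1/n]. In terms of the log-ratio s of
the two values of a row, its slope is gain(s)/s, where gain' is a positive constant over A exp(s) +
B + C exp(−s), and A < C because n > 2. Hence, from rate zero on, the slope rises and then falls to
0 (`exists_unimodal_gain`), and the boundary is a chord from the origin to a point of tangency,
followed by the curve itself (`exists_critical_of_unimodal_slope`). The rate at tangency is R_c.

Equality forces each posterior to be uniform or a Hamming row. The uniform marginal and the rate
then fix the mass of each (`sum_weight_atom`), and counting the atoms of positive mass gives the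
minimal alphabet. -/

/-! ### Calculus: unimodal slopes and the chord-and-curve boundary -/

/-- The numerator of (M/s)'. The mean value theorem replaces a second derivative: M t − M s = M' ξ
(t − s) with M' ξ < M' t, so the increment exceeds s (M' t − M' s) ≥ 0. -/
theorem strictMonoOn_mul_deriv_sub {M M' : ℝ → ℝ} (hM : ∀ s, HasDerivAt M (M' s) s) {S : ℝ}
    (hmono : StrictMonoOn M' (Icc 0 S)) :
    StrictMonoOn (fun s => s * M' s - M s) (Icc 0 S) := by
  intro s hs t ht hst
  obtain ⟨ξ, hξ, h⟩ := exists_hasDerivAt_eq_slope M M' hst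
    (fun x _ => (hM x).continuousAt.continuousWithinAt) (fun x _ => hM x)
  have h1 : M' ξ < M' t := hmono ⟨hs.1.trans hξ.1.le, hξ.2.le.trans ht.2⟩ ht hξ.2
  have h2 : M' s < M' t := hmono hs ht hst
  rw [eq_div_iff (by linarith)] at h
  have h3 := mul_lt_mul_of_pos_right h1 (sub_pos.2 hst)
  have h4 := mul_le_mul_of_nonneg_left h2.le hs.1
  simp only
  linarith

theorem strictAntiOn_mul_deriv_sub {M M' : ℝ → ℝ} (hM : ∀ s, HasDerivAt M (M' s) s) {S : ℝ}
    (hS : 0 ≤ S) (hanti : StrictAntiOn M' (Ici S)) :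
    StrictAntiOn (fun s => s * M' s - M s) (Ici S) := by
  intro s hs t ht hst
  obtain ⟨ξ, hξ, h⟩ := exists_hasDerivAt_eq_slope M M' hst
    (fun x _ => (hM x).continuousAt.continuousWithinAt) (fun x _ => hM x)
  have h1 : M' t < M' ξ := hanti (le_trans hs hξ.1.le) ht hξ.2
  have h2 : M' t < M' s := hanti hs ht hst
  rw [eq_div_iff (by linarith)] at h
  have h3 := mul_lt_mul_of_pos_right h1 (sub_pos.2 hst)
  have h4 := mul_le_mul_of_nonneg_left h2.le (hS.trans hs)
  simp only
  linarith

/-- If `M'` increases, then decreases, and decays exponentially, then `M s / s` is unimodal. -/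
theorem exists_unimodal_div {M M' : ℝ → ℝ} (hM : ∀ s, HasDerivAt M (M' s) s)
    (hM' : Continuous M') (h0 : M 0 = 0) {S c : ℝ} (hS : 0 < S)
    (hmono : StrictMonoOn M' (Icc 0 S)) (hanti : StrictAntiOn M' (Ici S))
    (hpos : ∀ s, 0 < M' s) (hc : ∀ s, M' s ≤ c * Real.exp (-s)) :
    ∃ s₁ > 0, StrictMonoOn (fun s => M s / s) (Ioc 0 s₁) ∧
      StrictAntiOn (fun s => M s / s) (Ici s₁) := by
  have hMmono : StrictMono M := strictMono_of_hasDerivAt_pos hM hpos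
  have hMc : Continuous M := continuous_iff_continuousAt.2 fun s => (hM s).continuousAt
  set ψ : ℝ → ℝ := fun s => s * M' s - M s with hψ
  have hψc : Continuous ψ := (continuous_id.mul hM').sub hMc
  have hψ0 : ψ 0 = 0 := by simp [hψ, h0]
  have hψm := strictMonoOn_mul_deriv_sub hM hmono
  have hψa := strictAntiOn_mul_deriv_sub hM hS.le hanti
  have hψpos : ∀ s ∈ Ioc 0 S, 0 < ψ s := fun s hs => by
    rw [← hψ0]
    exact hψm ⟨le_rfl, hS.le⟩ ⟨hs.1.le, hs.2⟩ hs.1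
  have hMS : 0 < M S := by rw [← h0]; exact hMmono hS
  -- Far out, s M' s tends to 0 while M s stays above M S > 0.
  obtain ⟨u, hu, hSu⟩ : ∃ u, ψ u < 0 ∧ S < u := by
    have ht : Tendsto (fun s : ℝ => c * (s ^ 1 * Real.exp (-s))) atTop (𝓝 (c * 0)) :=
      (Real.tendsto_pow_mul_exp_neg_atTop_nhds_zero 1).const_mul c
    rw [mul_zero] at ht
    obtain ⟨u, hu, hSu⟩ := ((ht.eventually_lt_const hMS).and (eventually_gt_atTop S)).exists
    refine ⟨u, ?_, hSu⟩
    have h1 := mul_le_mul_of_nonneg_left (hc u) (hS.trans hSu).le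
    have h2 := hMmono hSu
    simp only [hψ]
    rw [pow_one] at hu
    linarith
  obtain ⟨s₁, hs₁, hz⟩ : (0 : ℝ) ∈ ψ '' Icc S u :=
    intermediate_value_Icc' hSu.le hψc.continuousOn ⟨hu.le, (hψpos S ⟨hS, le_rfl⟩).le⟩
  have hs₁0 : 0 < s₁ := hS.trans_le hs₁.1
  have hder : ∀ s > 0, HasDerivAt (fun s => M s / s) (ψ s / s ^ 2) s := fun s hs => by
    refine ((hM s).fun_div (hasDerivAt_id' s) hs.ne').congr_deriv ?_
    simp only [hψ]
    ring
  refine ⟨s₁, hs₁0, ?_, ?_⟩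
  · refine strictMonoOn_of_deriv_pos (convex_Ioc _ _)
      (fun s hs => (hder s hs.1).continuousAt.continuousWithinAt) fun s hs => ?_
    rw [interior_Ioc] at hs
    rw [(hder s hs.1).deriv]
    -- ψ rises from 0 on [0, S] and decreases afterwards, so `s₁` is its only positive zero.
    refine div_pos ?_ (pow_pos hs.1 2)
    rcases le_or_gt s S with h | h
    · exact hψpos s ⟨hs.1, h⟩
    · rw [← hz]
      exact hψa h.le hs₁.1 hs.2
  · refine strictAntiOn_of_deriv_neg (convex_Ici _)
      (fun s hs => (hder s (hs₁0.trans_le hs)).continuousAt.continuousWithinAt) fun s hs => ?_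
    rw [interior_Ici] at hs
    rw [(hder s (hs₁0.trans hs)).deriv]
    refine div_neg_of_neg_of_pos ?_ (pow_pos (hs₁0.trans hs) 2)
    rw [← hz]
    exact hψa hs₁.1 (hs₁.1.trans (le_of_lt hs)) hs

/-- M + c exp(−s) is antitone and equals c at 0. -/
theorem le_of_deriv_le_exp {M M' : ℝ → ℝ} (hM : ∀ s, HasDerivAt M (M' s) s) (h0 : M 0 = 0)
    {c : ℝ} (hc0 : 0 ≤ c) (hc : ∀ s, M' s ≤ c * Real.exp (-s)) {s : ℝ} (hs : 0 ≤ s) :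
    M s ≤ c := by
  have hd : ∀ x, HasDerivAt (fun x => M x + c * Real.exp (-x)) (M' x + c * (Real.exp (-x) * -1)) x :=
    fun x => (hM x).add (((hasDerivAt_neg x).exp).const_mul c)
  have := antitone_of_hasDerivAt_nonpos hd (fun x => by have := hc x; simp only [Pi.zero_apply]; linarith)
  have := this hs
  simp only [h0, neg_zero, Real.exp_zero] at this
  have := mul_nonneg hc0 (Real.exp_pos (-s)).le
  linarith

/-- A curve `b ↦ (ρ b, Φ b)` on `[0, e]` whose slope `m` is unimodal: the upper boundary of the
convex hull is the segment from the point at `e` to the point at some `bc`, followed by the part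
of the curve over `[0, bc]`. -/
theorem exists_critical_of_unimodal_slope {Φ ρ m w : ℝ → ℝ} {e b₁ : ℝ}
    (hΦ : ContinuousOn Φ (Icc 0 e)) (hρ : ContinuousOn ρ (Icc 0 e))
    (hm : ContinuousOn m (Ioo 0 e))
    (dΦ : ∀ b ∈ Ioo 0 e, HasDerivAt Φ (-(w b * m b)) b)
    (dρ : ∀ b ∈ Ioo 0 e, HasDerivAt ρ (-w b) b)
    (hw : ∀ b ∈ Ioo 0 e, 0 < w b) (hm0 : ∀ b ∈ Ioo 0 e, 0 < m b)
    (hΦe : Φ e = 0) (hρe : ρ e = 0) (hb₁ : b₁ ∈ Ioo 0 e)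
    (hmono : StrictMonoOn m (Ioc 0 b₁)) (hanti : StrictAntiOn m (Ico b₁ e))
    (hsmall : ∀ ε > 0, ∃ b ∈ Ioc 0 b₁, m b < ε) :
    ∃ bc ∈ Ioo 0 e, ∃ μc > 0, Φ bc = μc * ρ bc ∧
      (∀ b ∈ Icc 0 e, b ≠ bc → b ≠ e → Φ b < μc * ρ b) ∧
      ∀ β ∈ Ico 0 bc, ∃ μ ≥ 0, ∀ b ∈ Icc 0 e, b ≠ β → Φ b - μ * ρ b < Φ β - μ * ρ β := by
  have he : 0 < e := hb₁.1.trans hb₁.2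
  have hk : ∀ μ, ContinuousOn (fun b => Φ b - μ * ρ b) (Icc 0 e) := fun μ =>
    hΦ.sub (continuousOn_const.mul hρ)
  -- The Lagrangian rises where m < μ and falls where m > μ; all later comparisons rest on this.
  have dk : ∀ μ, ∀ b ∈ Ioo 0 e, HasDerivAt (fun b => Φ b - μ * ρ b) (w b * (μ - m b)) b := by
    intro μ b hb
    refine ((dΦ b hb).fun_sub ((dρ b hb).const_mul μ)).congr_deriv ?_
    ring
  have inc : ∀ μ u v, 0 ≤ u → v ≤ e → u < v → (∀ b ∈ Ioo u v, m b < μ) →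
      Φ u - μ * ρ u < Φ v - μ * ρ v := by
    intro μ u v hu hv huv h
    refine strictMonoOn_of_deriv_pos (convex_Icc u v) ((hk μ).mono (Icc_subset_Icc hu hv))
      (fun b hb => ?_) ⟨le_rfl, huv.le⟩ ⟨huv.le, le_rfl⟩ huv
    rw [interior_Icc] at hb
    have hb' : b ∈ Ioo 0 e := ⟨hu.trans_lt hb.1, hb.2.trans_le hv⟩
    rw [(dk μ b hb').deriv]
    exact mul_pos (hw b hb') (sub_pos.2 (h b hb))
  have dec : ∀ μ u v, 0 ≤ u → v ≤ e → u < v → (∀ b ∈ Ioo u v, μ < m b) →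
      Φ v - μ * ρ v < Φ u - μ * ρ u := by
    intro μ u v hu hv huv h
    refine strictAntiOn_of_deriv_neg (convex_Icc u v) ((hk μ).mono (Icc_subset_Icc hu hv))
      (fun b hb => ?_) ⟨le_rfl, huv.le⟩ ⟨huv.le, le_rfl⟩ huv
    rw [interior_Icc] at hb
    have hb' : b ∈ Ioo 0 e := ⟨hu.trans_lt hb.1, hb.2.trans_le hv⟩
    rw [(dk μ b hb').deriv]
    exact mul_neg_of_pos_of_neg (hw b hb') (sub_neg.2 (h b hb))
  have hρanti : StrictAntiOn ρ (Icc 0 e) := by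
    refine strictAntiOn_of_deriv_neg (convex_Icc 0 e) hρ fun b hb => ?_
    rw [interior_Icc] at hb
    rw [(dρ b hb).deriv]
    exact neg_neg_of_pos (hw b hb)
  have hρpos : ∀ b ∈ Ico 0 e, 0 < ρ b := fun b hb => by
    rw [← hρe]
    exact hρanti ⟨hb.1, hb.2.le⟩ ⟨he.le, le_rfl⟩ hb.2
  have dec0 : ∀ u v, 0 ≤ u → v ≤ e → u < v → Φ v < Φ u := fun u v hu hv huv => by
    have := dec 0 u v hu hv huv fun b hb => hm0 b ⟨hu.trans_lt hb.1, hb.2.trans_le hv⟩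
    simpa using this
  -- the maximum of `Φ - m β * ρ` for `β ≤ b₁`
  have left : ∀ β ∈ Ioc 0 b₁, ∀ b, 0 ≤ b → b < β → Φ b - m β * ρ b < Φ β - m β * ρ β :=
    fun β hβ b hb hbβ => inc _ _ _ hb (hβ.2.trans hb₁.2.le) hbβ fun x hx =>
      hmono ⟨hb.trans_lt hx.1, hx.2.le.trans hβ.2⟩ hβ hx.2
  -- Either m is still above m β at b, hence on all of (β, b) by unimodality, or it is below from b
  -- to e, and the Lagrangian climbs to its value 0 at e.
  have right : ∀ β ∈ Ioc 0 b₁, ∀ b ∈ Ioo β e,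
      Φ b - m β * ρ b < Φ β - m β * ρ β ∨ Φ b - m β * ρ b < 0 := by
    intro β hβ b hb
    by_cases h : b ≤ b₁
    · exact Or.inl <| dec _ _ _ hβ.1.le hb.2.le hb.1 fun x hx =>
        hmono hβ ⟨hβ.1.trans hx.1, hx.2.le.trans h⟩ hx.1
    push Not at h
    by_cases h' : m β < m b
    · refine Or.inl <| dec _ _ _ hβ.1.le hb.2.le hb.1 fun x hx => ?_
      rcases le_or_gt x b₁ with hx1 | hx1
      · exact hmono hβ ⟨hβ.1.trans hx.1, hx1⟩ hx.1
      · exact h'.trans (hanti ⟨hx1.le, hx.2.trans hb.2⟩ ⟨h.le, hb.2⟩ hx.2)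
    · push Not at h'
      right
      have := inc (m β) b e (hβ.1.trans hb.1).le le_rfl hb.2 fun x hx =>
        (hanti ⟨h.le, hb.2⟩ ⟨(h.trans hx.1).le, hx.2⟩ hx.1).trans_le h'
      rwa [hΦe, hρe, mul_zero, sub_zero] at this
  -- The intercept of the tangent at b; `bc` is where the tangent passes through the origin.
  set τ : ℝ → ℝ := fun b => Φ b - m b * ρ b with hτ
  have hτanti : StrictAntiOn τ (Ioc 0 b₁) := by
    intro u hu v hv huv
    have h1 := dec (m u) u v hu.1.le (hv.2.trans hb₁.2.le) huv fun x hx =>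
      hmono hu ⟨hu.1.trans hx.1, hx.2.le.trans hv.2⟩ hx.1
    have h2 := mul_lt_mul_of_pos_right (hmono hu hv huv)
      (hρpos v ⟨hv.1.le, hv.2.trans_lt hb₁.2⟩)
    simp only [hτ]
    linarith
  have hτb₁ : τ b₁ < 0 := by
    have := inc (m b₁) b₁ e hb₁.1.le le_rfl hb₁.2 fun x hx =>
      hanti ⟨le_rfl, hb₁.2⟩ ⟨hx.1.le, hx.2⟩ hx.1
    rwa [hΦe, hρe, mul_zero, sub_zero] at this
  have hΦb₁ : 0 < Φ b₁ := by
    rw [← hΦe]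
    exact dec0 b₁ e hb₁.1.le le_rfl hb₁.2
  have hρ0 : 0 < ρ 0 := hρpos 0 ⟨le_rfl, he⟩
  -- This bound gives m δ * ρ δ ≤ m δ * ρ 0 < Φ b₁ ≤ Φ δ, so the intercept at δ is positive.
  obtain ⟨δ, hδ, hmδ⟩ := hsmall (Φ b₁ / ρ 0) (div_pos hΦb₁ hρ0)
  have hτδ : 0 < τ δ := by
    have hδe : δ ≤ e := hδ.2.trans hb₁.2.le
    have h1 : Φ b₁ ≤ Φ δ := by
      rcases hδ.2.eq_or_lt with h | h
      · rw [h]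
      · exact (dec0 δ b₁ hδ.1.le hb₁.2.le h).le
    have h2 : ρ δ ≤ ρ 0 := (hρanti ⟨le_rfl, he.le⟩ ⟨hδ.1.le, hδe⟩ hδ.1).le
    rw [lt_div_iff₀ hρ0] at hmδ
    have h3 := mul_le_mul_of_nonneg_left h2 (hm0 δ ⟨hδ.1, hδ.2.trans_lt hb₁.2⟩).le
    simp only [hτ]
    linarith
  have hsub : Icc δ b₁ ⊆ Ioo 0 e := fun x hx => ⟨hδ.1.trans_le hx.1, hx.2.trans_lt hb₁.2⟩
  obtain ⟨bc, hbc, hz⟩ : (0 : ℝ) ∈ τ '' Icc δ b₁ :=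
    intermediate_value_Icc' hδ.2
      ((hΦ.mono (hsub.trans Ioo_subset_Icc_self)).sub
        ((hm.mono hsub).mul (hρ.mono (hsub.trans Ioo_subset_Icc_self)))) ⟨hτb₁.le, hτδ.le⟩
  have hbc' : bc ∈ Ioc 0 b₁ := ⟨hδ.1.trans_le hbc.1, hbc.2⟩
  simp only [hτ] at hz
  refine ⟨bc, hsub hbc, m bc, hm0 bc (hsub hbc), by linarith, fun b hb hne hne' => ?_,
    fun β hβ => ?_⟩
  · rcases lt_or_gt_of_ne hne with h | h
    · have := left bc hbc' b hb.1 h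
      linarith
    · rcases right bc hbc' b ⟨h, lt_of_le_of_ne hb.2 hne'⟩ with h | h <;> linarith
  · rcases hβ.1.eq_or_lt with h0 | h0
    · subst h0
      -- At the endpoint a horizontal line supports, since Φ is strictly decreasing.
      refine ⟨0, le_rfl, fun b hb hne => ?_⟩
      have := dec0 0 b le_rfl hb.2 (lt_of_le_of_ne hb.1 hne.symm)
      simpa using this
    · have hβ' : β ∈ Ioc 0 b₁ := ⟨h0, hβ.2.le.trans hbc.2⟩
      have hτβ : 0 < Φ β - m β * ρ β := by
        have := hτanti hβ' hbc' hβ.2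
        simp only [hτ] at this
        linarith
      refine ⟨m β, (hm0 β ⟨h0, hβ'.2.trans_lt hb₁.2⟩).le, fun b hb hne => ?_⟩
      rcases lt_or_gt_of_ne hne with h | h
      · exact left β hβ' b hb.1 h
      · rcases hb.2.eq_or_lt with h' | h'
        · rw [h', hΦe, hρe]
          linarith
        · rcases right β hβ' b ⟨h, h'⟩ with h | h <;> linarith

/-! ### The gain of the Hamming channel in the log-ratio -/

/-- The increment of the denominator factors as (exp t − exp s)(A − C exp(−(s+t))), whose sign turns
at s + t = log (C/A). -/
theorem strictMonoOn_div_expSum {A B C k : ℝ} (hA : 0 < A) (hB : 0 < B) (hAC : A < C)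
    (hk : 0 < k) :
    StrictMonoOn (fun s => k / (A * Real.exp s + B + C * Real.exp (-s)))
      (Icc 0 (Real.log (C / A) / 2)) ∧
    StrictAntiOn (fun s => k / (A * Real.exp s + B + C * Real.exp (-s)))
      (Ici (Real.log (C / A) / 2)) := by
  have hC : 0 < C := hA.trans hAC
  have hQ : ∀ s, 0 < A * Real.exp s + B + C * Real.exp (-s) := fun s => by positivity
  have key : ∀ s t, (A * Real.exp t + B + C * Real.exp (-t)) -
      (A * Real.exp s + B + C * Real.exp (-s)) =
      (Real.exp t - Real.exp s) * (A - C * Real.exp (-(s + t))) := by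
    intro s t
    have h1 : Real.exp t * Real.exp (-(s + t)) = Real.exp (-s) := by
      rw [← Real.exp_add]; ring_nf
    have h2 : Real.exp s * Real.exp (-(s + t)) = Real.exp (-t) := by
      rw [← Real.exp_add]; ring_nf
    linear_combination -C * h2 + C * h1
  have hexp : C * Real.exp (-Real.log (C / A)) = A := by
    rw [Real.exp_neg, Real.exp_log (by positivity)]
    field_simp
  constructor
  · intro s hs t ht hst
    refine div_lt_div_of_pos_left hk (hQ t) ?_
    rw [← sub_neg, key]
    refine mul_neg_of_pos_of_neg (sub_pos.2 (Real.exp_lt_exp.2 hst)) ?_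
    have : Real.exp (-Real.log (C / A)) < Real.exp (-(s + t)) :=
      Real.exp_lt_exp.2 (by linarith [ht.2])
    have := mul_lt_mul_of_pos_left this hC
    linarith
  · intro s hs t ht hst
    refine div_lt_div_of_pos_left hk (hQ s) ?_
    rw [← sub_pos, key]
    refine mul_pos (sub_pos.2 (Real.exp_lt_exp.2 hst)) ?_
    have : Real.exp (-(s + t)) < Real.exp (-Real.log (C / A)) :=
      Real.exp_lt_exp.2 (by linarith [mem_Ici.1 hs])
    have := mul_lt_mul_of_pos_left this hC
    linarith

/-- The logarithmic derivative gain of the Hamming channel as a function of the log-ratio `s`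
of the two values of its input. -/
noncomputable def gain (ν α s : ℝ) : ℝ :=
  (1 - ν * α) * (Real.log ((1 - (ν - 1) * α) * Real.exp s + (ν - 1) * α) -
    Real.log (α * Real.exp s + (1 - α)))

/-- The denominator is the product of the arguments of the two logarithms in `gain`, divided by `exp
s`. The square in the numerator makes α below and above 1/ν alike. -/
noncomputable def gainDeriv (ν α s : ℝ) : ℝ :=
  (1 - ν * α) ^ 2 / (α * (1 - (ν - 1) * α) * Real.exp s +
    ((1 - (ν - 1) * α) * (1 - α) + (ν - 1) * α ^ 2) + (ν - 1) * α * (1 - α) * Real.exp (-s))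

theorem hasDerivAt_gain {ν α : ℝ} (hν : 1 < ν) (hα0 : 0 < α) (hγ : 0 < 1 - (ν - 1) * α)
    (hα1 : 0 < 1 - α) (s : ℝ) : HasDerivAt (gain ν α) (gainDeriv ν α s) s := by
  have hν' : 0 < ν - 1 := sub_pos.2 hν
  have he := Real.exp_pos s
  have h1 : 0 < (1 - (ν - 1) * α) * Real.exp s + (ν - 1) * α := by positivity
  have h2 : 0 < α * Real.exp s + (1 - α) := by positivity
  have d1 := (((Real.hasDerivAt_exp s).const_mul (1 - (ν - 1) * α)).add_const ((ν - 1) * α)).log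
    h1.ne'
  have d2 := (((Real.hasDerivAt_exp s).const_mul α).add_const (1 - α)).log h2.ne'
  refine ((d1.fun_sub d2).const_mul (1 - ν * α)).congr_deriv ?_
  have h3 : 0 < α * (1 - (ν - 1) * α) * Real.exp s +
    ((1 - (ν - 1) * α) * (1 - α) + (ν - 1) * α ^ 2) + (ν - 1) * α * (1 - α) * Real.exp (-s) := by
    have := Real.exp_pos (-s)
    positivity
  have h4 : α * (1 - (ν - 1) * α) * Real.exp s +
    ((1 - (ν - 1) * α) * (1 - α) + (ν - 1) * α ^ 2) + (ν - 1) * α * (1 - α) * Real.exp (-s) =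
    ((1 - (ν - 1) * α) * Real.exp s + (ν - 1) * α) * (α * Real.exp s + (1 - α)) / Real.exp s := by
    rw [Real.exp_neg]
    field_simp
    ring
  rw [gainDeriv, h4, div_sub_div _ _ h1.ne' h2.ne', div_div_eq_mul_div, ← mul_div_assoc]
  congr 1
  ring

theorem exists_unimodal_gain {ν α : ℝ} (hν : 2 < ν) (hα0 : 0 < α) (hγ : 0 < 1 - (ν - 1) * α)
    (hα1 : 0 < 1 - α) (hl : 1 - ν * α ≠ 0) :
    (∃ s₁ > 0, StrictMonoOn (fun s => gain ν α s / s) (Ioc 0 s₁) ∧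
      StrictAntiOn (fun s => gain ν α s / s) (Ici s₁)) ∧
    (∀ s > 0, 0 < gain ν α s) ∧ ∃ c, ∀ s ≥ 0, gain ν α s ≤ c := by
  have hν' : 0 < ν - 1 := by linarith
  have hd := hasDerivAt_gain (by linarith) hα0 hγ hα1
  have hA : 0 < α * (1 - (ν - 1) * α) := by positivity
  have hB : 0 < (1 - (ν - 1) * α) * (1 - α) + (ν - 1) * α ^ 2 := by positivity
  have hC : 0 < (ν - 1) * α * (1 - α) := by positivity
  -- This is 1 < ν − 1; it places the turning point log (C/A) / 2 on the positive axis.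
  have hAC : α * (1 - (ν - 1) * α) < (ν - 1) * α * (1 - α) := by nlinarith
  have hk : 0 < (1 - ν * α) ^ 2 := by positivity
  have h0 : gain ν α 0 = 0 := by simp [gain]
  have hQ : ∀ s, α * (1 - (ν - 1) * α) * Real.exp s <
      α * (1 - (ν - 1) * α) * Real.exp s + ((1 - (ν - 1) * α) * (1 - α) + (ν - 1) * α ^ 2) +
        (ν - 1) * α * (1 - α) * Real.exp (-s) := fun s => by
    have := mul_pos hC (Real.exp_pos (-s))
    linarith
  have hpos : ∀ s, 0 < gainDeriv ν α s := fun s =>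
    div_pos hk ((mul_pos hA (Real.exp_pos s)).trans (hQ s))
  have hc : ∀ s, gainDeriv ν α s ≤
      (1 - ν * α) ^ 2 / (α * (1 - (ν - 1) * α)) * Real.exp (-s) := fun s => by
    rw [Real.exp_neg, ← div_eq_mul_inv, div_div]
    exact div_le_div_of_nonneg_left hk.le (mul_pos hA (Real.exp_pos s)) (hQ s).le
  obtain ⟨hm, ha⟩ := strictMonoOn_div_expSum hA hB hAC hk
  refine ⟨exists_unimodal_div hd ?_ h0 ?_ hm ha hpos hc, fun s hs => ?_, _, fun s hs =>
    le_of_deriv_le_exp hd h0 (div_pos hk hA).le hc hs⟩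
  · refine continuous_const.div (by fun_prop) fun s => ?_
    exact ((mul_pos hA (Real.exp_pos s)).trans (hQ s)).ne'
  · exact half_pos (Real.log_pos ((one_lt_div hA).2 hAC))
  · rw [← h0]
    exact strictMono_of_hasDerivAt_pos hd hpos hs

/-! ### The curve of Hamming rows, parametrized by the crossover -/

/-- The log-ratio of the two values of the distribution `(1 - (ν-1) b, b, …, b)`. -/
noncomputable def logRatio (ν b : ℝ) : ℝ := Real.log (1 - (ν - 1) * b) - Real.log b

theorem strictAntiOn_logRatio {ν : ℝ} (hν : 1 < ν) :
    StrictAntiOn (logRatio ν) (Ioo 0 (1 / (ν - 1))) := by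
  intro x hx y hy hxy
  have hν' : 0 < ν - 1 := sub_pos.2 hν
  have hy2 := (lt_div_iff₀ hν').1 hy.2
  have h1 : 0 < 1 - (ν - 1) * y := by linarith
  have h2 : 1 - (ν - 1) * y < 1 - (ν - 1) * x := by nlinarith
  have h3 := Real.log_lt_log h1 h2
  have h4 := Real.log_lt_log hx.1 hxy
  simp only [logRatio]
  linarith

theorem logRatio_pos {ν b : ℝ} (hν : 1 < ν) (hb : b ∈ Ioo 0 (1 / ν)) : 0 < logRatio ν b := by
  have := (lt_div_iff₀ (by linarith)).1 hb.2
  exact sub_pos.2 (Real.log_lt_log hb.1 (by linarith))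

theorem logRatio_exp {ν s : ℝ} (hν : 1 < ν) : logRatio ν (1 / (Real.exp s + ν - 1)) = s := by
  have h : 0 < Real.exp s + ν - 1 := by have := Real.exp_pos s; linarith
  have h1 : 1 - (ν - 1) * (1 / (Real.exp s + ν - 1)) = Real.exp s * (1 / (Real.exp s + ν - 1)) := by
    field_simp
    ring
  rw [logRatio, h1, Real.log_mul (Real.exp_pos s).ne' (by positivity), Real.log_exp]
  ring

theorem one_div_exp_mem {ν s : ℝ} (hν : 1 < ν) (hs : 0 < s) :
    1 / (Real.exp s + ν - 1) ∈ Ioo 0 (1 / ν) := by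
  have := Real.one_lt_exp_iff.2 hs
  exact ⟨one_div_pos.2 (by linarith), one_div_lt_one_div_of_lt (by linarith) (by linarith)⟩

theorem crossover_pos {γ α x : ℝ} (hα0 : 0 < α) (hγ : 0 < γ) (hx0 : 0 ≤ x) (hx1 : x ≤ 1) :
    0 < α + (γ - α) * x := by
  rcases hx0.eq_or_lt with rfl | h
  · simpa
  · nlinarith [mul_nonneg hα0.le (sub_nonneg.2 hx1), mul_pos hγ h]

/-- Up to the factor n − 1, the right side is the derivative of b ↦ `hEnt` at the output crossover,
and `logRatio` is that of `hEnt` itself, so the slope of the curve is gain(s)/s. -/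
theorem gain_logRatio {ν α b : ℝ} (hν : 1 < ν) (hα0 : 0 < α) (hγ : 0 < 1 - (ν - 1) * α)
    (hb : b ∈ Ioo 0 (1 / ν)) :
    gain ν α (logRatio ν b) = (1 - ν * α) * logRatio ν (α + (1 - ν * α) * b) := by
  have hν' : 0 < ν - 1 := sub_pos.2 hν
  have hb2 := (lt_div_iff₀ (by linarith)).1 hb.2
  have ha : 0 < 1 - (ν - 1) * b := by linarith [hb.1]
  have hb0 := hb.1
  have hb1 : b ≤ 1 := by nlinarith
  have ha1 : 1 - (ν - 1) * b ≤ 1 := by nlinarith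
  have p1 := crossover_pos hα0 hγ hb.1.le hb1
  have p2 := crossover_pos hα0 hγ ha.le ha1
  have hexp : Real.exp (logRatio ν b) = (1 - (ν - 1) * b) / b := by
    rw [logRatio, ← Real.log_div ha.ne' hb.1.ne', Real.exp_log (div_pos ha hb.1)]
  have e1 : (1 - (ν - 1) * α) * ((1 - (ν - 1) * b) / b) + (ν - 1) * α =
      (α + (1 - (ν - 1) * α - α) * (1 - (ν - 1) * b)) / b := by
    field_simp
    ring
  have e2 : α * ((1 - (ν - 1) * b) / b) + (1 - α) =
      (α + (1 - (ν - 1) * α - α) * b) / b := by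
    field_simp
    ring
  rw [gain, hexp, e1, e2, Real.log_div p2.ne' hb.1.ne', Real.log_div p1.ne' hb.1.ne', logRatio]
  congr 1
  rw [show α + (1 - (ν - 1) * α - α) * (1 - (ν - 1) * b) =
      1 - (ν - 1) * (α + (1 - ν * α) * b) by ring,
    show α + (1 - (ν - 1) * α - α) * b = α + (1 - ν * α) * b by ring]
  ring

theorem hEnt_eq_negMulLog (n : ℕ) (q : ℝ) :
    hEnt n q = Real.negMulLog (1 - ((n : ℝ) - 1) * q) + ((n : ℝ) - 1) * Real.negMulLog q := by
  simp only [hEnt, Real.negMulLog]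
  ring

theorem continuous_hEnt (n : ℕ) : Continuous (hEnt n) := by
  have : hEnt n = fun q =>
    Real.negMulLog (1 - ((n : ℝ) - 1) * q) + ((n : ℝ) - 1) * Real.negMulLog q :=
    funext (hEnt_eq_negMulLog n)
  rw [this]
  exact (Real.continuous_negMulLog.comp (by fun_prop)).add
    (continuous_const.mul Real.continuous_negMulLog)

theorem hasDerivAt_hEnt {n : ℕ} {q : ℝ} (h0 : q ≠ 0) (h1 : 1 - ((n : ℝ) - 1) * q ≠ 0) :
    HasDerivAt (hEnt n) (((n : ℝ) - 1) * logRatio n q) q := by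
  have d1 : HasDerivAt (fun q : ℝ => 1 - ((n : ℝ) - 1) * q) (-(((n : ℝ) - 1) * 1)) q :=
    ((hasDerivAt_id' q).const_mul _).const_sub 1
  have d := ((Real.hasDerivAt_negMulLog h1).comp q d1).add
    ((Real.hasDerivAt_negMulLog h0).const_mul ((n : ℝ) - 1))
  have e : hEnt n = (Real.negMulLog ∘ fun q : ℝ => 1 - ((n : ℝ) - 1) * q) +
      fun q => ((n : ℝ) - 1) * Real.negMulLog q := by
    funext q
    simp [hEnt_eq_negMulLog]
  rw [e]
  refine d.congr_deriv ?_
  simp only [logRatio]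
  ring

theorem hEnt_zero (n : ℕ) : hEnt n 0 = 0 := by simp [hEnt]

theorem hEnt_one_div {n : ℕ} (hn : n ≠ 0) : hEnt n (1 / n) = Real.log n := by
  have hn' : (n : ℝ) ≠ 0 := Nat.cast_ne_zero.2 hn
  have : 1 - ((n : ℝ) - 1) * (1 / n) = 1 / n := by field_simp; ring
  rw [hEnt, this, one_div, Real.log_inv]
  field_simp
  ring

/-- The envelope of the parametric curve of informations of Hamming channels. -/
theorem exists_critical_crossover {n : ℕ} (hn : 3 ≤ n) {α : ℝ} (hα0 : 0 < α)
    (hα1 : α < 1 / ((n : ℝ) - 1)) (hαn : α ≠ 1 / (n : ℝ)) :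
    ∃ bc ∈ Ioo 0 (1 / (n : ℝ)), ∃ μc > 0,
      Real.log n - hEnt n (α + (1 - n * α) * bc) = μc * (Real.log n - hEnt n bc) ∧
      (∀ b ∈ Icc 0 (1 / (n : ℝ)), b ≠ bc → b ≠ 1 / (n : ℝ) →
        Real.log n - hEnt n (α + (1 - n * α) * b) < μc * (Real.log n - hEnt n b)) ∧
      ∀ β ∈ Ico 0 bc, ∃ μ ≥ 0, ∀ b ∈ Icc 0 (1 / (n : ℝ)), b ≠ β →
        Real.log n - hEnt n (α + (1 - n * α) * b) - μ * (Real.log n - hEnt n b) <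
        Real.log n - hEnt n (α + (1 - n * α) * β) - μ * (Real.log n - hEnt n β) := by
  have hn' : (3 : ℝ) ≤ n := by exact_mod_cast hn
  have hn0 : (0 : ℝ) < n := by linarith
  have hν : (1 : ℝ) < n := by linarith
  have hν1 : (0 : ℝ) < (n : ℝ) - 1 := by linarith
  have hα2 := (lt_div_iff₀ hν1).1 hα1
  have hγ : 0 < 1 - ((n : ℝ) - 1) * α := by linarith
  have hα1' : 0 < 1 - α := by nlinarith
  have hl : 1 - (n : ℝ) * α ≠ 0 := fun h => hαn (by field_simp; linarith)
  obtain ⟨⟨s₁, hs₁, hmono, hanti⟩, hgpos, c, hc⟩ :=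
    exists_unimodal_gain (by linarith) hα0 hγ hα1' hl
  have hsub : Ioo 0 (1 / (n : ℝ)) ⊆ Ioo 0 (1 / ((n : ℝ) - 1)) :=
    Ioo_subset_Ioo_right (one_div_le_one_div_of_le hν1 (by linarith))
  have hσa := (strictAntiOn_logRatio hν).mono hsub
  have hσ0 : ∀ b ∈ Ioo 0 (1 / (n : ℝ)), 0 < logRatio n b := fun b hb => logRatio_pos hν hb
  set b₁ : ℝ := 1 / (Real.exp s₁ + n - 1) with hb₁
  have hb₁m : b₁ ∈ Ioo 0 (1 / (n : ℝ)) := one_div_exp_mem hν hs₁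
  have hσb₁ : logRatio n b₁ = s₁ := logRatio_exp hν
  have hpos : ∀ b ∈ Icc 0 (1 / (n : ℝ)), 0 ≤ b ∧ b ≤ 1 ∧ 0 ≤ 1 - ((n : ℝ) - 1) * b ∧
      1 - ((n : ℝ) - 1) * b ≤ 1 := fun b hb => by
    have h1 := (le_div_iff₀ hn0).1 hb.2
    have h2 := mul_nonneg hν1.le hb.1
    exact ⟨hb.1, by linarith [hb.1], by linarith [hb.1], by linarith⟩
  have hout : ∀ b ∈ Icc 0 (1 / (n : ℝ)), 0 < α + (1 - n * α) * b ∧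
      0 < 1 - ((n : ℝ) - 1) * (α + (1 - n * α) * b) := fun b hb => by
    obtain ⟨h1, h2, h3, h4⟩ := hpos b hb
    constructor
    · have := crossover_pos hα0 hγ h1 h2
      linarith
    · have := crossover_pos hα0 hγ h3 h4
      linarith
  have hin : ∀ b ∈ Ioo 0 (1 / (n : ℝ)), 0 < 1 - ((n : ℝ) - 1) * b := fun b hb => by
    have h1 := (lt_div_iff₀ hn0).1 hb.2
    linarith [hb.1]
  have hgc : Continuous (gain n α) :=
    continuous_iff_continuousAt.2 fun s => (hasDerivAt_gain hν hα0 hγ hα1' s).continuousAt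
  have hσc : ContinuousOn (logRatio n) (Ioo 0 (1 / (n : ℝ))) :=
    ContinuousOn.sub (ContinuousOn.log (by fun_prop) fun b hb => (hin b hb).ne')
      (ContinuousOn.log (by fun_prop) fun b hb => hb.1.ne')
  refine exists_critical_of_unimodal_slope (b₁ := b₁)
    (Φ := fun b => Real.log n - hEnt n (α + (1 - n * α) * b))
    (ρ := fun b => Real.log n - hEnt n b)
    (m := fun b => gain n α (logRatio n b) / logRatio n b)
    (w := fun b => ((n : ℝ) - 1) * logRatio n b) ?_ ?_ ?_ ?_ ?_ ?_ ?_ ?_ ?_ hb₁m ?_ ?_ ?_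
  · exact (continuous_const.sub ((continuous_hEnt n).comp (by fun_prop))).continuousOn
  · exact (continuous_const.sub (continuous_hEnt n)).continuousOn
  · exact (hgc.comp_continuousOn hσc).div hσc fun b hb => (hσ0 b hb).ne'
  · intro b hb
    have hbI : b ∈ Icc 0 (1 / (n : ℝ)) := ⟨hb.1.le, hb.2.le⟩
    have d1 : HasDerivAt (fun b : ℝ => α + (1 - n * α) * b) ((1 - n * α) * 1) b :=
      ((hasDerivAt_id' b).const_mul _).const_add α
    have d := ((hasDerivAt_hEnt (hout b hbI).1.ne' (hout b hbI).2.ne').comp b d1).const_sub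
      (Real.log n)
    refine d.congr_deriv ?_
    rw [mul_assoc _ (logRatio n b), mul_div_cancel₀ _ (hσ0 b hb).ne', gain_logRatio hν hα0 hγ hb]
    ring
  · exact fun b hb => (hasDerivAt_hEnt hb.1.ne' (hin b hb).ne').const_sub (Real.log n)
  · exact fun b hb => mul_pos hν1 (hσ0 b hb)
  · exact fun b hb => div_pos (hgpos _ (hσ0 b hb)) (hσ0 b hb)
  · have : α + (1 - n * α) * (1 / (n : ℝ)) = 1 / n := by field_simp; ring
    simp only [this, hEnt_one_div (by omega : n ≠ 0), sub_self]
  · simp only [hEnt_one_div (by omega : n ≠ 0), sub_self]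
  -- `logRatio` decreases in b, so monotonicity in s is reversed.
  · intro x hx y hy hxy
    have hxI : x ∈ Ioo 0 (1 / (n : ℝ)) := ⟨hx.1, hx.2.trans_lt hb₁m.2⟩
    have hyI : y ∈ Ioo 0 (1 / (n : ℝ)) := ⟨hy.1, hy.2.trans_lt hb₁m.2⟩
    have h : ∀ z ∈ Ioc 0 b₁, s₁ ≤ logRatio n z := fun z hz => by
      rw [← hσb₁]
      exact hσa.antitoneOn ⟨hz.1, hz.2.trans_lt hb₁m.2⟩ hb₁m hz.2
    exact hanti (h y hy) (h x hx) (hσa hxI hyI hxy)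
  · intro x hx y hy hxy
    have hxI : x ∈ Ioo 0 (1 / (n : ℝ)) := ⟨hb₁m.1.trans_le hx.1, hx.2⟩
    have hyI : y ∈ Ioo 0 (1 / (n : ℝ)) := ⟨hb₁m.1.trans_le hy.1, hy.2⟩
    have h : ∀ z ∈ Ico b₁ (1 / (n : ℝ)), logRatio n z ∈ Ioc 0 s₁ := fun z hz => by
      have hzI : z ∈ Ioo 0 (1 / (n : ℝ)) := ⟨hb₁m.1.trans_le hz.1, hz.2⟩
      refine ⟨hσ0 z hzI, ?_⟩
      rw [← hσb₁]
      exact hσa.antitoneOn hb₁m hzI hz.1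
    exact hmono (h y hy) (h x hx) (hσa hxI hyI hxy)
  · intro ε hε
    -- The gain is at most c, so the slope is below ε once s > |c|/ε; the maximum with `s₁` keeps
    -- the crossover at most `b₁`.
    set s := max s₁ (|c| / ε + 1) with hs
    have hs1 : |c| / ε < s := (lt_add_one _).trans_le (le_max_right _ _)
    have hs0 : 0 < s := hs₁.trans_le (le_max_left _ _)
    refine ⟨1 / (Real.exp s + n - 1), ⟨(one_div_exp_mem hν hs0).1, ?_⟩, ?_⟩
    · refine one_div_le_one_div_of_le ?_ ?_
      · have := Real.exp_pos s₁
        linarith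
      · have := Real.exp_le_exp.2 (le_max_left s₁ (|c| / ε + 1))
        linarith
    · simp only [logRatio_exp hν]
      rw [div_lt_iff₀ hs0]
      rw [div_lt_iff₀ hε] at hs1
      have := hc s hs0.le
      have := le_abs_self c
      linarith

theorem strictMonoOn_hEnt {n : ℕ} (hn : 2 ≤ n) :
    StrictMonoOn (hEnt n) (Icc 0 (1 / (n : ℝ))) := by
  have hn' : (1 : ℝ) < n := by exact_mod_cast hn
  refine strictMonoOn_of_deriv_pos (convex_Icc _ _) (continuous_hEnt n).continuousOn
    fun b hb => ?_
  rw [interior_Icc] at hb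
  have h1 := (lt_div_iff₀ (by linarith)).1 hb.2
  have hb1 := hb.1
  rw [(hasDerivAt_hEnt hb.1.ne' (by linarith)).deriv]
  exact mul_pos (by linarith) (logRatio_pos hn' hb)

theorem hInv_hEnt {n : ℕ} (hn : 2 ≤ n) {b : ℝ} (hb : b ∈ Icc 0 (1 / (n : ℝ))) :
    hInv n (hEnt n b) = b :=
  (strictMonoOn_hEnt hn).injOn.leftInvOn_invFunOn hb

theorem exists_hEnt_eq {n : ℕ} (hn : n ≠ 0) {y : ℝ} (hy0 : 0 ≤ y) (hy1 : y ≤ Real.log n) :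
    ∃ b ∈ Icc 0 (1 / (n : ℝ)), hEnt n b = y := by
  have := intermediate_value_Icc (f := hEnt n) (a := 0) (b := 1 / (n : ℝ)) (by positivity)
    (continuous_hEnt n).continuousOn
  rw [hEnt_zero, hEnt_one_div hn] at this
  exact this ⟨hy0, hy1⟩

/-! ### Concave-convex shape of the Lagrangian -/

/-- One summand of the Lagrangian `μ H(p) - H(W p)`. -/
noncomputable def lagrangian (α l μ x : ℝ) : ℝ :=
  μ * Real.negMulLog x - Real.negMulLog (α + l * x)

theorem continuous_lagrangian (α l μ : ℝ) : Continuous (lagrangian α l μ) :=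
  (continuous_const.mul Real.continuous_negMulLog).sub
    (Real.continuous_negMulLog.comp (by fun_prop))

theorem hasDerivAt_lagrangian {α l μ x : ℝ} (hx : x ≠ 0) (hy : α + l * x ≠ 0) :
    HasDerivAt (lagrangian α l μ)
      (μ * (-Real.log x - 1) - l * (-Real.log (α + l * x) - 1)) x := by
  have d1 : HasDerivAt (fun x : ℝ => α + l * x) (l * 1) x :=
    ((hasDerivAt_id' x).const_mul l).const_add α
  refine (((Real.hasDerivAt_negMulLog hx).const_mul μ).fun_sub
    ((Real.hasDerivAt_negMulLog hy).comp x d1)).congr_deriv ?_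
  ring

theorem hasDerivAt_deriv_lagrangian {α l μ x : ℝ} (hx : x ≠ 0) (hy : α + l * x ≠ 0) :
    HasDerivAt (fun x => μ * (-Real.log x - 1) - l * (-Real.log (α + l * x) - 1))
      ((l * (l - μ) * x - μ * α) / (x * (α + l * x))) x := by
  have d1 : HasDerivAt (fun x : ℝ => α + l * x) (l * 1) x :=
    ((hasDerivAt_id' x).const_mul l).const_add α
  refine ((((Real.hasDerivAt_log hx).fun_neg.sub_const 1).const_mul μ).fun_sub
    (((d1.log hy).fun_neg.sub_const 1).const_mul l)).congr_deriv ?_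
  change μ * -x⁻¹ - l * -(l * 1 / (α + l * x)) = _
  obtain ⟨y, rfl⟩ : ∃ y, α = y - l * x := ⟨α + l * x, by ring⟩
  rw [sub_add_cancel] at hy ⊢
  field_simp
  ring

/-- The second derivative has the sign of l(l − μ)x − μα, which is affine in x and nonpositive at 0,
so it changes sign at most once, from minus to plus. Either interval may degenerate to a point. -/
theorem exists_strictConcaveOn_strictConvexOn_lagrangian {α l μ : ℝ} (hα : 0 < α)
    (hαl : 0 < α + l) (hl : l ≠ 0) (hμ : 0 ≤ μ) :
    ∃ x₀ ∈ Icc (0 : ℝ) 1, StrictConcaveOn ℝ (Icc 0 x₀) (lagrangian α l μ) ∧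
      StrictConvexOn ℝ (Icc x₀ 1) (lagrangian α l μ) := by
  have hy : ∀ x ∈ Ioo (0 : ℝ) 1, 0 < α + l * x := fun x hx => by
    have := crossover_pos hα hαl hx.1.le hx.2.le
    simpa using this
  have hl2 : 0 < l ^ 2 := by positivity
  obtain ⟨x₀, hx₀, hneg, hpos⟩ : ∃ x₀ ∈ Icc (0 : ℝ) 1,
      (∀ x ∈ Ioo 0 x₀, l * (l - μ) * x - μ * α < 0) ∧
      ∀ x ∈ Ioo x₀ 1, 0 < l * (l - μ) * x - μ * α := by
    rcases le_or_gt (l * (l - μ)) 0 with hc | hc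
    · refine ⟨1, ⟨zero_le_one, le_rfl⟩, fun x hx => ?_, fun x hx => absurd hx.2 hx.1.not_gt⟩
      have hμ' : 0 < μ := by
        refine hμ.lt_of_ne fun h => ?_
        subst h
        nlinarith
      nlinarith [mul_nonneg (neg_nonneg.2 hc) hx.1.le, mul_pos hμ' hα]
    · have h0 : 0 ≤ μ * α / (l * (l - μ)) := by positivity
      refine ⟨min 1 (μ * α / (l * (l - μ))), ⟨le_min zero_le_one h0, min_le_left _ _⟩,
        fun x hx => ?_, fun x hx => ?_⟩
      · have := (lt_div_iff₀ hc).1 (hx.2.trans_le (min_le_right _ _))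
        linarith
      · have h1 : μ * α / (l * (l - μ)) < x := by
          rcases min_lt_iff.1 hx.1 with h | h
          · exact absurd h hx.2.not_gt
          · exact h
        rw [div_lt_iff₀ hc] at h1
        linarith
  refine ⟨x₀, hx₀, ?_, ?_⟩
  · refine StrictAntiOn.strictConcaveOn_of_deriv (convex_Icc _ _)
      (continuous_lagrangian _ _ _).continuousOn ?_
    rw [interior_Icc]
    have hmem : ∀ x ∈ Ioo 0 x₀, x ∈ Ioo (0 : ℝ) 1 := fun x hx => ⟨hx.1, hx.2.trans_le hx₀.2⟩
    refine StrictAntiOn.congr (strictAntiOn_of_deriv_neg (convex_Ioo 0 x₀)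
      (f := fun x => μ * (-Real.log x - 1) - l * (-Real.log (α + l * x) - 1))
      (fun x hx => (hasDerivAt_deriv_lagrangian hx.1.ne'
        (hy x (hmem x hx)).ne').continuousAt.continuousWithinAt) fun x hx => ?_)
      fun x hx => ((hasDerivAt_lagrangian hx.1.ne' (hy x (hmem x hx)).ne').deriv).symm
    rw [interior_Ioo] at hx
    rw [(hasDerivAt_deriv_lagrangian hx.1.ne' (hy x (hmem x hx)).ne').deriv]
    exact div_neg_of_neg_of_pos (hneg x hx) (mul_pos hx.1 (hy x (hmem x hx)))
  · refine StrictMonoOn.strictConvexOn_of_deriv (convex_Icc _ _)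
      (continuous_lagrangian _ _ _).continuousOn ?_
    rw [interior_Icc]
    have hmem : ∀ x ∈ Ioo x₀ 1, x ∈ Ioo (0 : ℝ) 1 := fun x hx => ⟨hx₀.1.trans_lt hx.1, hx.2⟩
    refine StrictMonoOn.congr (strictMonoOn_of_deriv_pos (convex_Ioo x₀ 1)
      (f := fun x => μ * (-Real.log x - 1) - l * (-Real.log (α + l * x) - 1))
      (fun x hx => (hasDerivAt_deriv_lagrangian (hmem x hx).1.ne'
        (hy x (hmem x hx)).ne').continuousAt.continuousWithinAt) fun x hx => ?_)
      fun x hx => ((hasDerivAt_lagrangian (hmem x hx).1.ne' (hy x (hmem x hx)).ne').deriv).symm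
    rw [interior_Ioo] at hx
    rw [(hasDerivAt_deriv_lagrangian (hmem x hx).1.ne' (hy x (hmem x hx)).ne').deriv]
    exact div_pos (hpos x hx) (mul_pos (hmem x hx).1 (hy x (hmem x hx)))

/-! ### Optimal distributions on the simplex -/

section Simplex

variable {A : Type*} [Fintype A]

/-- `log |A| - H(p)`. -/
noncomputable def deficit (p : A → ℝ) : ℝ := Real.log (Fintype.card A) - entropy p

theorem continuous_entropy : Continuous (entropy : (A → ℝ) → ℝ) :=
  continuous_finsetSum _ fun a _ => Real.continuous_negMulLog.comp (continuous_apply a)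

theorem continuous_deficit : Continuous (deficit : (A → ℝ) → ℝ) :=
  continuous_const.sub continuous_entropy

theorem continuous_outputDist (W : A → A → ℝ) : Continuous fun p => outputDist p W :=
  continuous_pi fun _ => continuous_finsetSum _ fun x _ =>
    (continuous_apply x).mul continuous_const

variable [DecidableEq A]

theorem sum_comp_update_update (G : ℝ → ℝ) (p : A → ℝ) {i j : A} (hij : i ≠ j) (u v : ℝ) :
    ∑ k, G (Function.update (Function.update p i u) j v k) =
      ∑ k, G (p k) + (G u - G (p i)) + (G v - G (p j)) := by
  have : ∀ k, G (Function.update (Function.update p i u) j v k) =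
      G (p k) + (if k = i then G u - G (p i) else 0) + (if k = j then G v - G (p j) else 0) := by
    intro k
    by_cases hj : k = j
    · subst hj
      simp [hij.symm]
    · by_cases hi : k = i
      · subst hi
        simp [hj]
      · simp [hi, hj]
  simp only [this, Finset.sum_add_distrib, Finset.sum_ite_eq', Finset.mem_univ, if_true]

/-- Moving mass between two coordinates stays in the simplex, so a maximizer resists every such
exchange. -/
theorem add_le_add_of_isMaxOn_sum {F : ℝ → ℝ} {p : A → ℝ} (hp : p ∈ stdSimplex ℝ A)
    (hmax : IsMaxOn (fun p : A → ℝ => ∑ k, F (p k)) (stdSimplex ℝ A) p) {i j : A} (hij : i ≠ j)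
    {u v : ℝ} (hu : 0 ≤ u) (hv : 0 ≤ v) (huv : u + v = p i + p j) :
    F u + F v ≤ F (p i) + F (p j) := by
  have hmem : Function.update (Function.update p i u) j v ∈ stdSimplex ℝ A := by
    refine ⟨fun k => ?_, ?_⟩
    · by_cases hj : k = j
      · subst hj
        simpa
      · by_cases hi : k = i
        · subst hi
          simpa [hj]
        · simpa [hi, hj] using hp.1 k
    · have := sum_comp_update_update id p hij u v
      simp only [id] at this
      rw [this, hp.2]
      linarith
  have h := isMaxOn_iff.1 hmax _ hmem
  rw [sum_comp_update_update F p hij u v] at h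
  linarith

/-- x and y are convex combinations of x₀ and x + y − x₀ with swapped weights; adding the two
convexity inequalities gives the claim. -/
theorem add_lt_add_of_strictConvexOn {F : ℝ → ℝ} {x₀ x y : ℝ}
    (hF : StrictConvexOn ℝ (Icc x₀ 1) F) (hx : x₀ < x) (hy : x₀ < y) (hxy : x + y - x₀ ≤ 1) :
    F x + F y < F x₀ + F (x + y - x₀) := by
  have hd : 0 < x + y - 2 * x₀ := by linarith
  have hd' := hd.ne'
  have h1 : 0 < (y - x₀) / (x + y - 2 * x₀) := div_pos (by linarith) hd
  have h2 : 0 < (x - x₀) / (x + y - 2 * x₀) := div_pos (by linarith) hd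
  have h3 : (y - x₀) / (x + y - 2 * x₀) + (x - x₀) / (x + y - 2 * x₀) = 1 := by
    rw [← add_div, div_eq_one_iff_eq hd']
    ring
  have hm1 : x₀ ∈ Icc x₀ 1 := ⟨le_rfl, by linarith⟩
  have hm2 : x + y - x₀ ∈ Icc x₀ 1 := ⟨by linarith, hxy⟩
  have hne : x₀ ≠ x + y - x₀ := by linarith
  have e1 := hF.2 hm1 hm2 hne h1 h2 h3
  have e2 := hF.2 hm1 hm2 hne h2 h1 (by linarith)
  have e3 : (y - x₀) / (x + y - 2 * x₀) * x₀ + (x - x₀) / (x + y - 2 * x₀) * (x + y - x₀) = x := by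
    rw [div_mul_eq_mul_div, div_mul_eq_mul_div, ← add_div, div_eq_iff hd']
    ring
  have e4 : (x - x₀) / (x + y - 2 * x₀) * x₀ + (y - x₀) / (x + y - 2 * x₀) * (x + y - x₀) = y := by
    rw [div_mul_eq_mul_div, div_mul_eq_mul_div, ← add_div, div_eq_iff hd']
    ring
  simp only [smul_eq_mul, e3, e4] at e1 e2
  have e5 : F x₀ + F (x + y - x₀) =
      ((y - x₀) / (x + y - 2 * x₀) + (x - x₀) / (x + y - 2 * x₀)) * (F x₀ + F (x + y - x₀)) := by
    rw [h3, one_mul]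
  linarith

theorem hamming_apply (α : ℝ) (x y : A) :
    hamming A α x y = α + (if x = y then 1 - (Fintype.card A : ℝ) * α else 0) := by
  unfold hamming
  split_ifs <;> ring

/-- A sum of a concave-convex function over the simplex is only maximal at distributions with one
large and otherwise equal values. -/
theorem exists_eq_hamming_of_isMaxOn_sum {F : ℝ → ℝ} {x₀ : ℝ} (hx₀ : 0 ≤ x₀)
    (hcave : StrictConcaveOn ℝ (Icc 0 x₀) F) (hvex : StrictConvexOn ℝ (Icc x₀ 1) F)
    (hA : 2 ≤ Fintype.card A) {p : A → ℝ} (hp : p ∈ stdSimplex ℝ A)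
    (hmax : IsMaxOn (fun p : A → ℝ => ∑ k, F (p k)) (stdSimplex ℝ A) p) :
    ∃ b ∈ Icc 0 (1 / (Fintype.card A : ℝ)), ∃ i, p = hamming A b i := by
  have hn : (0 : ℝ) < Fintype.card A := by
    have : 0 < Fintype.card A := by omega
    exact_mod_cast this
  have hpair : ∀ i j, i ≠ j → p i + p j ≤ 1 := fun i j hij => by
    rw [← hp.2, ← Finset.sum_pair hij]
    exact Finset.sum_le_sum_of_subset_of_nonneg (Finset.subset_univ _) fun k _ _ => hp.1 k
  -- Averaging two distinct coordinates in the concave range would increase the sum.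
  have heq : ∀ i j, p i ≤ x₀ → p j ≤ x₀ → p i = p j := by
    intro i j hi hj
    by_contra hne
    have hij : i ≠ j := fun h => hne (by rw [h])
    have h1 := hcave.2 ⟨hp.1 i, hi⟩ ⟨hp.1 j, hj⟩ hne
      (one_half_pos (α := ℝ)) one_half_pos (add_halves 1)
    have hm : 0 ≤ (1 / 2 : ℝ) • p i + (1 / 2 : ℝ) • p j := by
      have h2 := hp.1 i
      have h3 := hp.1 j
      simp only [smul_eq_mul]
      linarith
    have h2 := add_le_add_of_isMaxOn_sum hp hmax hij hm hm (by simp only [smul_eq_mul]; ring)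
    simp only [smul_eq_mul] at h1 h2
    linarith
  -- Two coordinates in the convex range could be spread apart, one of them down to x₀.
  have hone : ∀ i j, i ≠ j → x₀ < p i → p j ≤ x₀ := by
    intro i j hij hi
    by_contra! hj
    have h0 := hpair i j hij
    have h1 := add_lt_add_of_strictConvexOn hvex hi hj (by linarith)
    have h2 := add_le_add_of_isMaxOn_sum hp hmax hij (u := x₀) (v := p i + p j - x₀) hx₀
      (by linarith) (by ring)
    linarith
  have hform : ∀ i b, (∀ k, k ≠ i → p k = b) → b ≤ p i → 0 ≤ b →
      ∃ b ∈ Icc 0 (1 / (Fintype.card A : ℝ)), ∃ i, p = hamming A b i := by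
    intro i b hb hbi hb0
    have hpk : ∀ k, p k = b + if i = k then p i - b else 0 := fun k => by
      by_cases h : i = k
      · subst h
        simp
      · simp [h, hb k (Ne.symm h)]
    have hsum := hp.2
    rw [Finset.sum_congr rfl fun k _ => hpk k] at hsum
    simp only [Finset.sum_add_distrib, Finset.sum_const, Finset.card_univ, nsmul_eq_mul,
      Finset.sum_ite_eq, Finset.mem_univ, if_true] at hsum
    refine ⟨b, ⟨hb0, ?_⟩, i, funext fun k => ?_⟩
    · rw [le_div_iff₀ hn]
      linarith
    · rw [hamming_apply, hpk k]
      congr 1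
      split_ifs
      · linarith
      · rfl
  obtain ⟨a⟩ : Nonempty A := Fintype.card_pos_iff.1 (by omega)
  by_cases hall : ∀ k, p k ≤ x₀
  -- All coordinates agree: the uniform law, a Hamming row with crossover 1/n.
  · exact hform a (p a) (fun k _ => heq k a (hall k) (hall a)) le_rfl (hp.1 a)
  · push Not at hall
    obtain ⟨i, hi⟩ := hall
    obtain ⟨j, hj⟩ := Fintype.exists_ne_of_one_lt_card (by omega) i
    have hj' := hone i j hj.symm hi
    exact hform i (p j) (fun k hk => heq k j (hone i k hk.symm hi) hj') (hj'.trans hi.le) (hp.1 j)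

theorem outputDist_hamming {p : A → ℝ} (hp : ∑ x, p x = 1) (α : ℝ) :
    outputDist p (hamming A α) = fun y => α + (1 - (Fintype.card A : ℝ) * α) * p y := by
  funext y
  simp only [outputDist, hamming_apply, mul_add, Finset.sum_add_distrib, ← Finset.sum_mul, hp,
    mul_ite, mul_zero, Finset.sum_ite_eq', Finset.mem_univ, if_true]
  ring

theorem sum_hamming (α : ℝ) (x : A) : ∑ y, hamming A α x y = 1 := by
  simp only [hamming_apply, Finset.sum_add_distrib, Finset.sum_const, Finset.card_univ,
    nsmul_eq_mul, Finset.sum_ite_eq, Finset.mem_univ, if_true]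
  ring

theorem hamming_symm (α : ℝ) (x y : A) : hamming A α x y = hamming A α y x := by
  simp only [hamming, eq_comm]

theorem entropy_hamming (b : ℝ) (x : A) :
    entropy (hamming A b x) = hEnt (Fintype.card A) b := by
  have : ∀ y, Real.negMulLog (hamming A b x y) = Real.negMulLog b +
      if x = y then Real.negMulLog (1 - ((Fintype.card A : ℝ) - 1) * b) - Real.negMulLog b
        else 0 := fun y => by
    unfold hamming
    split_ifs <;> ring
  simp only [entropy, this, Finset.sum_add_distrib, Finset.sum_const, Finset.card_univ,
    nsmul_eq_mul, Finset.sum_ite_eq, Finset.mem_univ, if_true, hEnt_eq_negMulLog]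
  ring

theorem outputDist_hamming_hamming (α b : ℝ) (x : A) :
    outputDist (hamming A b x) (hamming A α) =
      hamming A (α + (1 - (Fintype.card A : ℝ) * α) * b) x := by
  rw [outputDist_hamming (sum_hamming b x)]
  funext y
  simp only [hamming_apply]
  split_ifs <;> ring

theorem hamming_mem_stdSimplex {b : ℝ} (hb : b ∈ Icc 0 (1 / (Fintype.card A : ℝ)))
    (x : A) : hamming A b x ∈ stdSimplex ℝ A := by
  have hn : (0 : ℝ) < Fintype.card A := by
    have : 0 < Fintype.card A := Fintype.card_pos_iff.2 ⟨x⟩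
    exact_mod_cast this
  have h1 := (le_div_iff₀ hn).1 hb.2
  refine ⟨fun y => ?_, sum_hamming b x⟩
  rw [hamming_apply]
  have := hb.1
  split_ifs <;> linarith

theorem hamming_one_div (x : A) :
    hamming A (1 / (Fintype.card A : ℝ)) x = uniform A := by
  have hn : (Fintype.card A : ℝ) ≠ 0 := by
    have : Fintype.card A ≠ 0 := (Fintype.card_pos_iff.2 ⟨x⟩).ne'
    exact_mod_cast this
  funext y
  rw [hamming_apply, mul_one_div_cancel hn, sub_self, ite_self, add_zero, uniform]

theorem deficit_hamming (b : ℝ) (x : A) :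
    deficit (hamming A b x) = Real.log (Fintype.card A) - hEnt (Fintype.card A) b := by
  rw [deficit, entropy_hamming]

/-- The channel acts on each coordinate by x ↦ α + (1 − nα)x, which makes the Lagrangian separable.
-/
theorem deficit_outputDist_sub {p : A → ℝ} (hp : ∑ x, p x = 1) (α μ : ℝ) :
    deficit (outputDist p (hamming A α)) - μ * deficit p =
      (1 - μ) * Real.log (Fintype.card A) +
        ∑ k, lagrangian α (1 - (Fintype.card A : ℝ) * α) μ (p k) := by
  rw [outputDist_hamming hp]
  simp only [deficit, entropy, lagrangian, Finset.sum_sub_distrib, ← Finset.mul_sum]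
  ring

/-- A bound on the Lagrangian at Hamming rows holds at all distributions, and equality only holds
at Hamming rows. -/
theorem deficit_outputDist_sub_le (hA : 2 ≤ Fintype.card A) {α : ℝ} (hα0 : 0 < α)
    (hγ : 0 < 1 - ((Fintype.card A : ℝ) - 1) * α) (hl : 1 - (Fintype.card A : ℝ) * α ≠ 0)
    {μ : ℝ} (hμ : 0 ≤ μ) {C : ℝ}
    (hC : ∀ b ∈ Icc 0 (1 / (Fintype.card A : ℝ)), ∀ i,
      deficit (hamming A (α + (1 - (Fintype.card A : ℝ) * α) * b) i) -
        μ * deficit (hamming A b i) ≤ C) {p : A → ℝ} (hp : p ∈ stdSimplex ℝ A) :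
    deficit (outputDist p (hamming A α)) - μ * deficit p ≤ C ∧
      (deficit (outputDist p (hamming A α)) - μ * deficit p = C →
        ∃ b ∈ Icc 0 (1 / (Fintype.card A : ℝ)), ∃ i, p = hamming A b i) := by
  obtain ⟨x₀, hx₀, hcave, hvex⟩ := exists_strictConcaveOn_strictConvexOn_lagrangian hα0
    (l := 1 - (Fintype.card A : ℝ) * α) (by linarith) hl hμ
  set S : (A → ℝ) → ℝ := fun p => ∑ k, lagrangian α (1 - (Fintype.card A : ℝ) * α) μ (p k)
  have hS : Continuous S := continuous_finsetSum _ fun k _ =>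
    (continuous_lagrangian _ _ _).comp (continuous_apply k)
  obtain ⟨p₀, hp₀, hmax⟩ := (isCompact_stdSimplex ℝ A).exists_isMaxOn ⟨p, hp⟩ hS.continuousOn
  obtain ⟨b, hb, i, rfl⟩ := exists_eq_hamming_of_isMaxOn_sum hx₀.1 hcave hvex hA hp₀ hmax
  have hle : (1 - μ) * Real.log (Fintype.card A) + S (hamming A b i) ≤ C := by
    rw [← deficit_outputDist_sub hp₀.2, outputDist_hamming_hamming]
    exact hC b hb i
  have hp' := isMaxOn_iff.1 hmax p hp
  rw [deficit_outputDist_sub hp.2]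
  refine ⟨by linarith, fun h => ?_⟩
  -- The maximum is at most C, so a distribution reaching C is itself a maximizer.
  refine exists_eq_hamming_of_isMaxOn_sum hx₀.1 hcave hvex hA hp (isMaxOn_iff.2 fun q hq => ?_)
  have := isMaxOn_iff.1 hmax q hq
  simp only [S] at this hle ⊢
  linarith

/-- Lifts `exists_critical_crossover` from Hamming rows to the whole simplex. The critical line
touches twice, at the uniform law and at the rows with crossover `bc`; the steeper rates have a
single contact. -/
theorem exists_critical_deficit {n : ℕ} (hn : 3 ≤ n) (hA : Fintype.card A = n) {α : ℝ}
    (hα0 : 0 < α) (hα1 : α < 1 / ((n : ℝ) - 1)) (hαn : α ≠ 1 / (n : ℝ)) :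
    ∃ bc ∈ Ioo 0 (1 / (n : ℝ)), ∃ μc > 0,
      Real.log n - hEnt n (α + (1 - n * α) * bc) = μc * (Real.log n - hEnt n bc) ∧
      (∀ p ∈ stdSimplex ℝ A, deficit (outputDist p (hamming A α)) ≤ μc * deficit p ∧
        (deficit (outputDist p (hamming A α)) = μc * deficit p →
          p = uniform A ∨ ∃ i, p = hamming A bc i)) ∧
      ∀ β ∈ Ico 0 bc, ∃ μ ≥ 0, ∀ p ∈ stdSimplex ℝ A,
        deficit (outputDist p (hamming A α)) - μ * deficit p ≤
          Real.log n - hEnt n (α + (1 - n * α) * β) - μ * (Real.log n - hEnt n β) ∧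
        (deficit (outputDist p (hamming A α)) - μ * deficit p =
          Real.log n - hEnt n (α + (1 - n * α) * β) - μ * (Real.log n - hEnt n β) →
          ∃ i, p = hamming A β i) := by
  subst hA
  set n := Fintype.card A
  have hn' : (3 : ℝ) ≤ n := by exact_mod_cast hn
  have hγ : 0 < 1 - ((n : ℝ) - 1) * α := by
    have := (lt_div_iff₀ (by linarith)).1 hα1
    linarith
  have hl : 1 - (n : ℝ) * α ≠ 0 := fun h => hαn (by field_simp; linarith)
  have hone : α + (1 - n * α) * (1 / (n : ℝ)) = 1 / n := by field_simp; ring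
  obtain ⟨bc, hbc, μc, hμc, heq, hlt, hleft⟩ := exists_critical_crossover hn hα0 hα1 hαn
  refine ⟨bc, hbc, μc, hμc, heq, fun p hp => ?_, fun β hβ => ?_⟩
  · have hC : ∀ b ∈ Icc 0 (1 / (n : ℝ)), ∀ i : A,
        deficit (hamming A (α + (1 - (n : ℝ) * α) * b) i) - μc * deficit (hamming A b i) ≤ 0 := by
      intro b hb i
      rw [deficit_hamming, deficit_hamming]
      by_cases hb1 : b = bc
      · rw [hb1]
        linarith
      · by_cases hb2 : b = 1 / n
        · have h1 : hEnt n (1 / n) = Real.log n := hEnt_one_div (by omega)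
          rw [hb2, hone]
          change Real.log n - hEnt n (1 / n) - μc * (Real.log n - hEnt n (1 / n)) ≤ 0
          rw [h1, sub_self, mul_zero, sub_zero]
        · have := hlt b hb hb1 hb2
          linarith
    obtain ⟨h1, h2⟩ := deficit_outputDist_sub_le (by omega) hα0 hγ hl hμc.le hC hp
    refine ⟨by linarith, fun h => ?_⟩
    obtain ⟨b, hb, i, rfl⟩ := h2 (by linarith)
    by_cases hb1 : b = bc
    · exact Or.inr ⟨i, by rw [hb1]⟩
    · by_cases hb2 : b = 1 / n
      · left
        rw [hb2, hamming_one_div]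
      · have := hlt b hb hb1 hb2
        rw [outputDist_hamming_hamming, deficit_hamming, deficit_hamming] at h
        exact absurd h this.ne
  · obtain ⟨μ, hμ, hk⟩ := hleft β hβ
    refine ⟨μ, hμ, fun p hp => ?_⟩
    have hC : ∀ b ∈ Icc 0 (1 / (n : ℝ)), ∀ i : A,
        deficit (hamming A (α + (1 - (n : ℝ) * α) * b) i) - μ * deficit (hamming A b i) ≤
          Real.log n - hEnt n (α + (1 - n * α) * β) - μ * (Real.log n - hEnt n β) := by
      intro b hb i
      rw [deficit_hamming, deficit_hamming]
      by_cases hb1 : b = β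
      · rw [hb1]
      · exact (hk b hb hb1).le
    obtain ⟨h1, h2⟩ := deficit_outputDist_sub_le (by omega) hα0 hγ hl hμ hC hp
    refine ⟨h1, fun h => ?_⟩
    obtain ⟨b, hb, i, rfl⟩ := h2 h
    by_cases hb1 : b = β
    · exact ⟨i, by rw [hb1]⟩
    · have := hk b hb hb1
      rw [outputDist_hamming_hamming, deficit_hamming, deficit_hamming] at h
      exact absurd h this.ne

end Simplex

/-! ### Mutual information as an average of deficits -/

section Decomposition

variable {A : Type*} [Fintype A]

theorem entropy_uniform [Nonempty A] : entropy (uniform A) = Real.log (Fintype.card A) := by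
  have h : (Fintype.card A : ℝ) ≠ 0 := Nat.cast_ne_zero.2 Fintype.card_ne_zero
  simp only [entropy, uniform, Finset.sum_const, Finset.card_univ, nsmul_eq_mul, Real.negMulLog,
    one_div, Real.log_inv]
  field_simp

theorem deficit_uniform [Nonempty A] : deficit (uniform A) = 0 := by
  rw [deficit, entropy_uniform, sub_self]

theorem uniform_mem_stdSimplex [Nonempty A] : uniform A ∈ stdSimplex ℝ A := by
  have h : (Fintype.card A : ℝ) ≠ 0 := Nat.cast_ne_zero.2 Fintype.card_ne_zero
  refine ⟨fun _ => by simp only [uniform]; positivity, ?_⟩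
  simp [uniform, h]

variable {T : Type*} [Fintype T]

/-- Mutual information of a joint distribution with uniform first marginal, decomposed as a
mixture of the conditional distributions `s t`. -/
theorem mutualInfo_eq_sum_deficit [Nonempty A] {J : A → T → ℝ} {P : T → ℝ} {s : T → A → ℝ}
    (hJ : ∀ a t, J a t = P t * s t a) (hs : ∀ t, P t ≠ 0 → ∑ a, s t a = 1)
    (hrow : ∀ a, ∑ t, J a t = uniform A a) :
    mutualInfo J = ∑ t, P t * deficit (s t) := by
  have hcol : ∀ t, ∑ a, J a t = P t := fun t => by
    simp only [hJ, ← Finset.mul_sum]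
    by_cases h : P t = 0
    · simp [h]
    · rw [hs t h, mul_one]
  have hP : ∑ t, P t = 1 := by
    rw [← uniform_mem_stdSimplex (A := A).2, ← Finset.sum_congr rfl fun a _ => hrow a,
      Finset.sum_comm]
    exact Finset.sum_congr rfl fun t _ => (hcol t).symm
  have hjoint : entropy (fun ab : A × T => J ab.1 ab.2) =
      ∑ t, (Real.negMulLog (P t) + P t * entropy (s t)) := by
    simp only [entropy]
    rw [Fintype.sum_prod_type_right]
    refine Finset.sum_congr rfl fun t _ => ?_
    simp only [hJ, Real.negMulLog_mul, Finset.sum_add_distrib, ← Finset.sum_mul,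
      ← Finset.mul_sum]
    by_cases h : P t = 0
    · simp [h]
    · rw [hs t h, one_mul]
  have hrow' : (fun a => ∑ t, J a t) = uniform A := funext hrow
  rw [mutualInfo, hjoint, hrow', entropy_uniform]
  simp only [hcol, deficit, mul_sub, Finset.sum_sub_distrib, ← Finset.sum_mul, hP,
    Finset.sum_add_distrib, entropy]
  ring

variable [DecidableEq A]

theorem outputDist_uniform_hamming [Nonempty A] (α : ℝ) :
    outputDist (uniform A) (hamming A α) = uniform A := by
  have h : (Fintype.card A : ℝ) ≠ 0 := Nat.cast_ne_zero.2 Fintype.card_ne_zero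
  rw [outputDist_hamming uniform_mem_stdSimplex.2]
  funext y
  simp only [uniform]
  field_simp
  ring

/-- Y is again uniform and its law given t is the image of `s t` under the channel, so one
decomposition serves both informations. -/
theorem info_eq_sum_deficit [Nonempty A] {q : A → T → ℝ} (hq : IsChannel q) {P : T → ℝ}
    {s : T → A → ℝ} (hJ : ∀ a t, uniform A a * q a t = P t * s t a)
    (hs : ∀ t, P t ≠ 0 → ∑ a, s t a = 1) (α : ℝ) :
    infoXT (uniform A) q = ∑ t, P t * deficit (s t) ∧
    infoYT (uniform A) (hamming A α) q =
      ∑ t, P t * deficit (outputDist (s t) (hamming A α)) := by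
  constructor
  · refine mutualInfo_eq_sum_deficit hJ hs fun a => ?_
    rw [← Finset.mul_sum, (hq a).2, mul_one]
  · refine mutualInfo_eq_sum_deficit (fun y t => ?_) (fun t ht => ?_) fun y => ?_
    · rw [outputDist, Finset.mul_sum]
      refine Finset.sum_congr rfl fun x _ => ?_
      rw [← mul_assoc, ← hJ]
      ring
    · simp only [outputDist]
      rw [Finset.sum_comm]
      simp only [← Finset.mul_sum, sum_hamming, mul_one]
      exact hs t ht
    · rw [Finset.sum_comm]
      simp only [← Finset.mul_sum, (hq _).2, mul_one]
      exact congrFun (outputDist_uniform_hamming α) y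

end Decomposition

/-! ### Posteriors of optimal channels and their masses -/

theorem exists_of_sum_filter_ne_zero {T B : Type*} [Fintype T] [DecidableEq B] {c : T → B}
    {f : T → ℝ} {o : B}
    (h : ∑ t with c t = o, f t ≠ 0) : ∃ t, c t = o := by
  obtain ⟨t, ht, _⟩ := Finset.exists_ne_zero_of_sum_ne_zero h
  exact ⟨t, (Finset.mem_filter.1 ht).2⟩

section Posterior

variable {A T : Type*} [Fintype A] [Fintype T]

/-- The probability of the output `t` for a uniform input. -/
noncomputable def weight (q : A → T → ℝ) (t : T) : ℝ := ∑ x, uniform A x * q x t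

/-- The distribution of a uniform input given the output `t`. -/
noncomputable def posterior (q : A → T → ℝ) (t : T) : A → ℝ :=
  fun x => uniform A x * q x t / weight q t

variable {q : A → T → ℝ}

theorem uniform_mul_nonneg (hq : IsChannel q) (x : A) (t : T) : 0 ≤ uniform A x * q x t :=
  mul_nonneg (by simp only [uniform]; positivity) ((hq x).1 t)

theorem weight_nonneg (hq : IsChannel q) (t : T) : 0 ≤ weight q t :=
  Finset.sum_nonneg fun x _ => uniform_mul_nonneg hq x t

theorem sum_weight [Nonempty A] (hq : IsChannel q) : ∑ t, weight q t = 1 := by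
  simp only [weight]
  rw [Finset.sum_comm, ← uniform_mem_stdSimplex (A := A).2]
  refine Finset.sum_congr rfl fun x _ => ?_
  rw [← Finset.mul_sum, (hq x).2, mul_one]

theorem weight_mul_posterior (hq : IsChannel q) (x : A) (t : T) :
    uniform A x * q x t = weight q t * posterior q t x := by
  by_cases h : weight q t = 0
  · rw [h, zero_mul]
    exact (Finset.sum_eq_zero_iff_of_nonneg fun x _ => uniform_mul_nonneg hq x t).1 h x
      (Finset.mem_univ x)
  · rw [posterior, mul_div_cancel₀ _ h]

theorem posterior_mem_stdSimplex (hq : IsChannel q) {t : T} (ht : weight q t ≠ 0) :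
    posterior q t ∈ stdSimplex ℝ A := by
  refine ⟨fun x => div_nonneg (uniform_mul_nonneg hq x t) (weight_nonneg hq t), ?_⟩
  simp only [posterior, ← Finset.sum_div]
  exact div_self ht

variable [DecidableEq A]

theorem infoXT_eq [Nonempty A] (hq : IsChannel q) :
    infoXT (uniform A) q = ∑ t, weight q t * deficit (posterior q t) :=
  (info_eq_sum_deficit hq (weight_mul_posterior hq)
    (fun _ ht => (posterior_mem_stdSimplex hq ht).2) 0).1

theorem infoYT_eq [Nonempty A] (hq : IsChannel q) (α : ℝ) :
    infoYT (uniform A) (hamming A α) q =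
      ∑ t, weight q t * deficit (outputDist (posterior q t) (hamming A α)) :=
  (info_eq_sum_deficit hq (weight_mul_posterior hq)
    (fun _ ht => (posterior_mem_stdSimplex hq ht).2) α).2

/-- A bound on the Lagrangian of single distributions passes to channels. -/
theorem infoYT_sub_le [Nonempty A] {α μ C : ℝ}
    (hC : ∀ p ∈ stdSimplex ℝ A, deficit (outputDist p (hamming A α)) - μ * deficit p ≤ C)
    (hq : IsChannel q) :
    infoYT (uniform A) (hamming A α) q - μ * infoXT (uniform A) q ≤ C ∧
      (infoYT (uniform A) (hamming A α) q - μ * infoXT (uniform A) q = C →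
        ∀ t, weight q t ≠ 0 → deficit (outputDist (posterior q t) (hamming A α)) -
          μ * deficit (posterior q t) = C) := by
  have h1 : infoYT (uniform A) (hamming A α) q - μ * infoXT (uniform A) q =
      ∑ t, weight q t * (deficit (outputDist (posterior q t) (hamming A α)) -
          μ * deficit (posterior q t)) := by
    rw [infoXT_eq hq, infoYT_eq hq, Finset.mul_sum, ← Finset.sum_sub_distrib]
    exact Finset.sum_congr rfl fun t _ => by ring
  have h2 : C = ∑ t, weight q t * C := by rw [← Finset.sum_mul, sum_weight hq, one_mul]
  have h3 : ∀ t ∈ Finset.univ, weight q t * (deficit (outputDist (posterior q t) (hamming A α)) -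
      μ * deficit (posterior q t)) ≤ weight q t * C := fun t _ => by
    by_cases ht : weight q t = 0
    · simp [ht]
    · exact mul_le_mul_of_nonneg_left (hC _ (posterior_mem_stdSimplex hq ht))
        (weight_nonneg hq t)
  constructor
  · rw [h1, h2]
    exact Finset.sum_le_sum h3
  · intro h t ht
    rw [h1, h2] at h
    exact mul_left_cancel₀ ht ((Finset.sum_eq_sum_iff_of_le h3).1 h t (Finset.mem_univ t))

/-- The bound on feasible channels that comes from a supporting line of the rate region at `R`. -/
theorem infoYT_le_of_support [Nonempty A] {α μ R v β : ℝ} (hμ : 0 ≤ μ)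
    (hC : ∀ p ∈ stdSimplex ℝ A, deficit (outputDist p (hamming A α)) - μ * deficit p ≤
      v - μ * R ∧ (deficit (outputDist p (hamming A α)) - μ * deficit p = v - μ * R →
        (p = uniform A ∨ ∃ i, p = hamming A β i) ∧ (0 < μ ∨ deficit p = R)))
    (hq : IsFeasible (uniform A) R q) :
    infoYT (uniform A) (hamming A α) q ≤ v ∧
      (infoYT (uniform A) (hamming A α) q = v →
        (∀ t, weight q t ≠ 0 → posterior q t = uniform A ∨ ∃ i, posterior q t = hamming A β i) ∧
          infoXT (uniform A) q = R) := by
  obtain ⟨h1, h2⟩ := infoYT_sub_le (fun p hp => (hC p hp).1) hq.1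
  have h3 := mul_le_mul_of_nonneg_left hq.2 hμ
  refine ⟨by linarith, fun h => ?_⟩
  have h4 := h2 (by linarith)
  have h5 : ∀ t, weight q t ≠ 0 → _ := fun t ht =>
    (hC _ (posterior_mem_stdSimplex hq.1 ht)).2 (h4 t ht)
  refine ⟨fun t ht => (h5 t ht).1, ?_⟩
  -- A positive slope makes the rate constraint tight; a horizontal line does not, and the rate must
  -- come from the contact points.
  rcases hμ.eq_or_lt with hμ0 | hμ0
  · rw [infoXT_eq hq.1]
    have : ∀ t ∈ Finset.univ, weight q t * deficit (posterior q t) = weight q t * R := by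
      intro t _
      by_cases ht : weight q t = 0
      · simp [ht]
      · rw [(h5 t ht).2.resolve_left (by simp [← hμ0])]
    rw [Finset.sum_congr rfl this, ← Finset.sum_mul, sum_weight hq.1, one_mul]
  · refine le_antisymm hq.2 (le_of_mul_le_mul_left ?_ hμ0)
    linarith

/-- The input distributions in the support of an optimal channel: uniform, or a Hamming row. -/
noncomputable def atom (β : ℝ) : Option A → A → ℝ
  | none => uniform A
  | some i => hamming A β i

theorem sum_atom [Nonempty A] (β : ℝ) (o : Option A) : ∑ x, atom β o x = 1 := by
  cases o with
  | none => exact uniform_mem_stdSimplex.2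
  | some i => exact sum_hamming β i

theorem deficit_atom [Nonempty A] (β : ℝ) (o : Option A) :
    deficit (atom β o) = if o = none then 0 else
      Real.log (Fintype.card A) - hEnt (Fintype.card A) β := by
  cases o with
  | none => exact deficit_uniform
  | some i => exact deficit_hamming β i

theorem deficit_outputDist_atom [Nonempty A] (α β : ℝ) (o : Option A) :
    deficit (outputDist (atom β o) (hamming A α)) = if o = none then 0 else
      Real.log (Fintype.card A) -
        hEnt (Fintype.card A) (α + (1 - (Fintype.card A : ℝ) * α) * β) := by
  cases o with
  | none =>
    simp only [atom, outputDist_uniform_hamming, deficit_uniform, if_true]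
  | some i =>
    simp only [atom, outputDist_hamming_hamming, deficit_hamming]
    simp

/-- The mass that an optimal channel puts on each atom. -/
theorem sum_weight_atom [Nonempty A] (hq : IsChannel q) {β s : ℝ}
    (hβ : β < 1 / (Fintype.card A : ℝ))
    (hD : 0 < Real.log (Fintype.card A) - hEnt (Fintype.card A) β) {c : T → Option A}
    (hc : ∀ t, weight q t ≠ 0 → posterior q t = atom β (c t))
    (hX : infoXT (uniform A) q = s * (Real.log (Fintype.card A) - hEnt (Fintype.card A) β)) :
    ∀ o, ∑ t with c t = o, weight q t =
      if o = none then 1 - s else s / (Fintype.card A : ℝ) := by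
  have hn0 : (0 : ℝ) < Fintype.card A := Nat.cast_pos.2 Fintype.card_pos
  have hβ' := (lt_div_iff₀ hn0).1 hβ
  have hc' : ∀ t (f : (A → ℝ) → ℝ), weight q t * f (posterior q t) =
      weight q t * f (atom β (c t)) := fun t f => by
    by_cases ht : weight q t = 0
    · simp [ht]
    · rw [hc t ht]
  set w : Option A → ℝ := fun o => ∑ t with c t = o, weight q t with hw
  -- Used with three test functions: g = 1 gives the total mass, the deficit gives the mass s of the
  -- Hamming atoms, and evaluation at x, through the uniform marginal, gives each single mass.
  have fiber : ∀ g : Option A → ℝ, ∑ t, weight q t * g (c t) =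
      w none * g none + ∑ i, w (some i) * g (some i) := fun g => by
    rw [← Fintype.sum_option (f := fun o => w o * g o),
      ← Finset.sum_fiberwise (s := Finset.univ) (g := c)]
    refine Finset.sum_congr rfl fun o _ => ?_
    rw [hw, Finset.sum_mul]
    exact Finset.sum_congr rfl fun t ht => by rw [(Finset.mem_filter.1 ht).2]
  have htot : w none + ∑ i, w (some i) = 1 := by
    have := fiber fun _ => 1
    simpa [sum_weight hq] using this.symm
  have hs : ∑ i, w (some i) = s := by
    have h := fiber fun o => deficit (atom β o)
    rw [← Finset.sum_congr rfl fun t _ => hc' t deficit, ← infoXT_eq hq, hX] at h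
    simp only [deficit_atom, if_true, mul_zero, zero_add, reduceCtorEq, if_false,
      ← Finset.sum_mul] at h
    exact (mul_right_cancel₀ hD.ne' h).symm
  have hx : ∀ x, w (some x) = s / (Fintype.card A : ℝ) := fun x => by
    have h := fiber fun o => atom β o x
    rw [← Finset.sum_congr rfl fun t _ => hc' t fun p => p x,
      ← Finset.sum_congr rfl fun t _ => weight_mul_posterior hq x t, ← Finset.mul_sum,
      (hq x).2, mul_one] at h
    simp only [atom, hamming_apply, mul_add, Finset.sum_add_distrib, ← Finset.sum_mul, hs,
      mul_ite, mul_zero, Finset.sum_ite_eq', Finset.mem_univ, if_true, uniform] at h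
    rw [eq_sub_of_add_eq htot, hs] at h
    have h' : w (some x) * (1 - (Fintype.card A : ℝ) * β) =
        s / (Fintype.card A : ℝ) * (1 - (Fintype.card A : ℝ) * β) := by
      field_simp at h ⊢
      linarith
    exact mul_right_cancel₀ (by linarith) h'
  intro o
  cases o with
  | none =>
    rw [if_pos rfl]
    change w none = _
    linarith
  | some x => exact hx x

theorem exists_atom {A T : Type*} [Fintype A] [DecidableEq A] {q : A → T → ℝ} {β : ℝ}
    (h : ∀ t, weight q t ≠ 0 → posterior q t = uniform A ∨ ∃ i, posterior q t = hamming A β i) :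
    ∃ c : T → Option A, ∀ t, weight q t ≠ 0 → posterior q t = atom β (c t) := by
  have : ∀ t, ∃ o : Option A, weight q t ≠ 0 → posterior q t = atom β o := fun t => by
    by_cases ht : weight q t = 0
    -- A symbol of weight zero may carry any label.
    · exact ⟨none, fun h => absurd ht h⟩
    · rcases h t ht with h | ⟨i, h⟩
      · exact ⟨none, fun _ => h⟩
      · exact ⟨some i, fun _ => h⟩
  choose c hc using this
  exact ⟨c, hc⟩

theorem eq_card_mul_weight_mul_atom [Nonempty A] (hq : IsChannel q) {β : ℝ} {c : T → Option A}
    (hc : ∀ t, weight q t ≠ 0 → posterior q t = atom β (c t)) (x : A) (t : T) :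
    q x t = Fintype.card A * weight q t * atom β (c t) x := by
  have hn0 : (0 : ℝ) < Fintype.card A := Nat.cast_pos.2 Fintype.card_pos
  have h := weight_mul_posterior hq x t
  have h' : weight q t * posterior q t x = weight q t * atom β (c t) x := by
    by_cases ht : weight q t = 0
    · simp [ht]
    · rw [hc t ht]
  rw [h', uniform] at h
  rw [mul_assoc, ← h]
  field_simp

/-- All n + 1 atoms have positive mass, so the labelling of symbols by atoms is onto; at n + 1
symbols it is bijective and is the relabelling. -/
theorem card_le_and_isRelabelling_timeShare [Nonempty A] (hq : IsChannel q) {β s : ℝ}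
    (hs : s ∈ Ioo (0 : ℝ) 1) (hβ : β < 1 / (Fintype.card A : ℝ))
    (hD : 0 < Real.log (Fintype.card A) - hEnt (Fintype.card A) β)
    (hp : ∀ t, weight q t ≠ 0 → posterior q t = uniform A ∨ ∃ i, posterior q t = hamming A β i)
    (hX : infoXT (uniform A) q = s * (Real.log (Fintype.card A) - hEnt (Fintype.card A) β)) :
    Fintype.card A + 1 ≤ Fintype.card T ∧
      (Fintype.card T = Fintype.card A + 1 → IsRelabelling q (timeShare s (hamming A β))) := by
  have hn0 : (0 : ℝ) < Fintype.card A := Nat.cast_pos.2 Fintype.card_pos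
  obtain ⟨c, hc⟩ := exists_atom hp
  have hw := sum_weight_atom hq hβ hD hc hX
  have hsurj : Function.Surjective c := fun o => exists_of_sum_filter_ne_zero (f := weight q) <| by
    rw [hw o]
    split_ifs
    · exact (sub_pos.2 hs.2).ne'
    · exact (div_pos hs.1 hn0).ne'
  refine ⟨by simpa using Fintype.card_le_of_surjective c hsurj, fun hcard => ?_⟩
  have hbij : Function.Bijective c :=
    (Fintype.bijective_iff_surjective_and_card c).2 ⟨hsurj, by simpa using hcard⟩
  refine ⟨Equiv.ofBijective c hbij, fun x t => ?_⟩
  have hwt : weight q t = if c t = none then 1 - s else s / (Fintype.card A : ℝ) := by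
    classical
    rw [← hw (c t)]
    simp only [hbij.1.eq_iff, Finset.sum_filter, Finset.sum_ite_eq', Finset.mem_univ, if_true]
  rw [eq_card_mul_weight_mul_atom hq hc, hwt, Equiv.ofBijective_apply]
  cases c t with
  | none =>
    simp only [if_true, atom, uniform, timeShare]
    field_simp
  | some i =>
    simp only [reduceCtorEq, if_false, atom, timeShare, hamming_symm β x i]
    field_simp

/-- The uniform atom now has mass 0 and its label may or may not occur, so the argument picks a
symbol for each Hamming row instead of using surjectivity of the labelling. -/
theorem card_le_and_isRelabelling_hamming [Nonempty A] (hq : IsChannel q) {β : ℝ}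
    (hβ : β < 1 / (Fintype.card A : ℝ))
    (hD : 0 < Real.log (Fintype.card A) - hEnt (Fintype.card A) β)
    (hp : ∀ t, weight q t ≠ 0 → posterior q t = uniform A ∨ ∃ i, posterior q t = hamming A β i)
    (hX : infoXT (uniform A) q = Real.log (Fintype.card A) - hEnt (Fintype.card A) β) :
    Fintype.card A ≤ Fintype.card T ∧
      (Fintype.card T = Fintype.card A → IsRelabelling q (hamming A β)) := by
  have hn0 : (0 : ℝ) < Fintype.card A := Nat.cast_pos.2 Fintype.card_pos
  obtain ⟨c, hc⟩ := exists_atom hp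
  have hw := sum_weight_atom hq hβ hD hc (s := 1) (by rw [one_mul, hX])
  have hex : ∀ i : A, ∃ t, c t = some i := fun i => exists_of_sum_filter_ne_zero (f := weight q) <| by
    rw [hw (some i), if_neg (by simp)]
    exact (div_pos one_pos hn0).ne'
  choose f hf using hex
  have hinj : Function.Injective f := fun i j h => by
    have := hf i
    rw [h, hf j] at this
    exact (Option.some_injective _ this).symm
  refine ⟨Fintype.card_le_of_injective f hinj, fun hcard => ?_⟩
  have hbij : Function.Bijective f :=
    (Fintype.bijective_iff_injective_and_card f).2 ⟨hinj, hcard.symm⟩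
  refine ⟨(Equiv.ofBijective f hbij).symm, fun x t => ?_⟩
  obtain ⟨i, rfl⟩ := hbij.2 t
  have hsymm : (Equiv.ofBijective f hbij).symm (f i) = i :=
    (Equiv.ofBijective f hbij).symm_apply_apply i
  have hwt : weight q (f i) = 1 / (Fintype.card A : ℝ) := by
    classical
    have h := hw (some i)
    have hiff : ∀ t, c t = some i ↔ t = f i := fun t => by
      obtain ⟨j, rfl⟩ := hbij.2 t
      rw [hf j, Option.some_inj, hinj.eq_iff]
    simp only [hiff, Finset.sum_filter, Finset.sum_ite_eq', Finset.mem_univ, if_true,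
      reduceCtorEq, if_false] at h
    exact h
  rw [eq_card_mul_weight_mul_atom hq hc, hwt, hsymm, hf, mul_one_div_cancel hn0.ne', one_mul,
    atom, hamming_symm]

theorem info_of_isRelabelling_timeShare [Nonempty A] (hq : IsChannel q) {β s : ℝ}
    (h : IsRelabelling q (timeShare s (hamming A β))) (α : ℝ) :
    infoXT (uniform A) q = s * (Real.log (Fintype.card A) - hEnt (Fintype.card A) β) ∧
    infoYT (uniform A) (hamming A α) q = s * (Real.log (Fintype.card A) -
      hEnt (Fintype.card A) (α + (1 - (Fintype.card A : ℝ) * α) * β)) := by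
  have hn0 : (Fintype.card A : ℝ) ≠ 0 := Nat.cast_ne_zero.2 Fintype.card_ne_zero
  obtain ⟨e, he⟩ := h
  set P : Option A → ℝ := fun o => if o = none then 1 - s else s / (Fintype.card A : ℝ)
  have hJ : ∀ a t, uniform A a * q a t = P (e t) * atom β (e t) a := fun a t => by
    rw [he]
    cases e t with
    | none =>
      simp only [P, if_true, atom, uniform, timeShare]
      ring
    | some i =>
      simp only [P, reduceCtorEq, if_false, atom, uniform, timeShare, hamming_symm β a i]
      ring
  obtain ⟨h1, h2⟩ := info_eq_sum_deficit hq hJ (fun t _ => sum_atom β (e t)) α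
  have key : ∀ v : ℝ, ∑ t, P (e t) * (if e t = none then 0 else v) = s * v := fun v => by
    rw [Equiv.sum_comp e fun o => P o * (if o = none then 0 else v), Fintype.sum_option]
    simp only [P, if_true, mul_zero, zero_add, reduceCtorEq, if_false, Finset.sum_const,
      Finset.card_univ, nsmul_eq_mul]
    field_simp
  simp only [deficit_atom, deficit_outputDist_atom, key] at h1 h2
  exact ⟨h1, h2⟩

theorem info_of_isRelabelling_hamming [Nonempty A] (hq : IsChannel q) {β : ℝ}
    (h : IsRelabelling q (hamming A β)) (α : ℝ) :
    infoXT (uniform A) q = Real.log (Fintype.card A) - hEnt (Fintype.card A) β ∧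
    infoYT (uniform A) (hamming A α) q = Real.log (Fintype.card A) -
      hEnt (Fintype.card A) (α + (1 - (Fintype.card A : ℝ) * α) * β) := by
  have hn0 : (Fintype.card A : ℝ) ≠ 0 := Nat.cast_ne_zero.2 Fintype.card_ne_zero
  obtain ⟨e, he⟩ := h
  obtain ⟨h1, h2⟩ := info_eq_sum_deficit hq (P := fun _ => 1 / (Fintype.card A : ℝ))
    (s := fun t => hamming A β (e t))
    (fun a t => by rw [he, hamming_symm, uniform]) (fun t _ => sum_hamming β (e t)) α
  have hT : (Fintype.card T : ℝ) = Fintype.card A := by rw [Fintype.card_congr e]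
  simp only [outputDist_hamming_hamming, deficit_hamming, Finset.sum_const,
        Finset.card_univ, nsmul_eq_mul, hT, ← mul_assoc, mul_one_div_cancel hn0, one_mul] at h1 h2
  exact ⟨h1, h2⟩

end Posterior

/-! ### The concave envelope and the critical rate -/

section Envelope

variable {A : Type*} [Fintype A] {W : A → A → ℝ} {μ : ℝ}

theorem mul_mem_upperBounds_phi (hμ : 0 ≤ μ)
    (hW : ∀ p ∈ stdSimplex ℝ A, deficit (outputDist p W) ≤ μ * deficit p) (R : ℝ) :
    μ * R ∈ upperBounds {v | ∃ p ∈ stdSimplex ℝ A, Real.log (Fintype.card A) - entropy p ≤ R ∧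
      v = Real.log (Fintype.card A) - entropy (outputDist p W)} := by
  rintro _ ⟨p, hp, hR, rfl⟩
  exact (hW p hp).trans (mul_le_mul_of_nonneg_left hR hμ)

theorem le_phi (hμ : 0 ≤ μ)
    (hW : ∀ p ∈ stdSimplex ℝ A, deficit (outputDist p W) ≤ μ * deficit p) {p : A → ℝ}
    (hp : p ∈ stdSimplex ℝ A) {R : ℝ} (hR : deficit p ≤ R) :
    deficit (outputDist p W) ≤ phi W R :=
  le_csSup ⟨_, mul_mem_upperBounds_phi hμ hW R⟩ ⟨p, hp, hR, rfl⟩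

variable [Nonempty A]

theorem phi_le (hμ : 0 ≤ μ)
    (hW : ∀ p ∈ stdSimplex ℝ A, deficit (outputDist p W) ≤ μ * deficit p) {R : ℝ} (hR : 0 ≤ R) :
    phi W R ≤ μ * R :=
  csSup_le ⟨_, uniform A, uniform_mem_stdSimplex, deficit_uniform.trans_le hR, rfl⟩
    fun _ hv => mul_mem_upperBounds_phi hμ hW R hv

/-- If a line through the origin supports `φ` exactly at zero and at the rate of `p`, then that
rate is the least positive one at which `φ` touches its upper concave envelope. -/
theorem isLeast_touchingSet (hμ : 0 < μ)
    (hW : ∀ p ∈ stdSimplex ℝ A, deficit (outputDist p W) ≤ μ * deficit p)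
    (hunif : outputDist (uniform A) W = uniform A) {p : A → ℝ} (hp : p ∈ stdSimplex ℝ A)
    (hp0 : 0 < deficit p) (hp1 : deficit p ≤ Real.log (Fintype.card A))
    (heq : deficit (outputDist p W) = μ * deficit p)
    (hW' : ∀ p' ∈ stdSimplex ℝ A, deficit (outputDist p' W) = μ * deficit p' →
      deficit p' = 0 ∨ deficit p' = deficit p) :
    IsLeast (touchingSet W) (deficit p) := by
  set L := Real.log (Fintype.card A)
  have hL : 0 < L := hp0.trans_le hp1
  have hphi : phi W (deficit p) = μ * deficit p :=
    le_antisymm (phi_le hμ.le hW hp0.le) (heq ▸ le_phi hμ.le hW hp le_rfl)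
  have hphi0 : 0 ≤ phi W 0 := by
    have := le_phi hμ.le hW uniform_mem_stdSimplex (deficit_uniform (A := A)).le
    rwa [hunif, deficit_uniform] at this
  have hline : ∃ g : ℝ → ℝ, ConcaveOn ℝ (Icc 0 L) g ∧ (∀ u ∈ Icc 0 L, phi W u ≤ g u) ∧
      ∀ r, g r = μ * r := by
    refine ⟨fun r => μ * r, ?_, fun u hu => phi_le hμ.le hW hu.1, fun _ => rfl⟩
    exact ((LinearMap.mul ℝ ℝ μ).concaveOn (convex_Icc _ _))
  -- A concave majorant is at least 0 at 0 and at least φ at the rate of p, hence lies above the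
  -- chord.
  have henv : ∀ R ∈ Icc 0 (deficit p), μ * R ≤ upperConcaveEnvelope (Icc 0 L) (phi W) R := by
    intro R hR
    obtain ⟨g, hg1, hg2, _⟩ := hline
    refine le_csInf ⟨_, g, hg1, hg2, rfl⟩ ?_
    rintro _ ⟨g, hg, hmaj, rfl⟩
    have h0 := hphi0.trans (hmaj 0 ⟨le_rfl, hL.le⟩)
    have h1 := hmaj (deficit p) ⟨hp0.le, hp1⟩
    rw [hphi] at h1
    have ha : 0 ≤ R / deficit p := div_nonneg hR.1 hp0.le
    have hb : 0 ≤ 1 - R / deficit p := sub_nonneg.2 ((div_le_one hp0).2 hR.2)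
    have h2 := hg.2 (x := 0) (y := deficit p) ⟨le_rfl, hL.le⟩ ⟨hp0.le, hp1⟩ hb ha (by ring)
    simp only [smul_eq_mul, mul_zero, zero_add, div_mul_cancel₀ R hp0.ne'] at h2
    have h3 := mul_nonneg hb h0
    have h4 := mul_le_mul_of_nonneg_left h1 ha
    have h5 : R / deficit p * (μ * deficit p) = μ * R := by field_simp
    linarith
  refine ⟨⟨hp0, hp1, ?_⟩, ?_⟩
  · refine le_antisymm (hphi.trans_le (henv _ ⟨hp0.le, le_rfl⟩)) ?_
    obtain ⟨g, hg1, hg2, hg3⟩ := hline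
    rw [hphi, ← hg3]
    refine csInf_le ⟨phi W (deficit p), ?_⟩ ⟨g, hg1, hg2, rfl⟩
    rintro _ ⟨g, _, hmaj, rfl⟩
    exact hmaj _ ⟨hp0.le, hp1⟩
  · rintro R ⟨hR0, _, hR⟩
    by_contra! hlt
    have h1 := henv R ⟨hR0.le, hlt.le⟩
    rw [← hR] at h1
    -- By compactness φ(R) is attained; touching at R forces its maximizer onto the line with rate
    -- exactly R, which lies strictly between the two permitted rates.
    have hcomp : IsCompact (stdSimplex ℝ A ∩ {p | deficit p ≤ R}) :=
      (isCompact_stdSimplex ℝ A).inter_right (isClosed_le continuous_deficit continuous_const)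
    obtain ⟨p₀, hp₀, hmax⟩ := hcomp.exists_isMaxOn
      ⟨uniform A, uniform_mem_stdSimplex, deficit_uniform.trans_le hR0.le⟩
      (continuous_deficit.comp (continuous_outputDist W)).continuousOn
    have h2 : phi W R ≤ deficit (outputDist p₀ W) := by
      refine csSup_le ⟨_, uniform A, uniform_mem_stdSimplex, deficit_uniform.trans_le hR0.le, rfl⟩ ?_
      rintro _ ⟨p', hp', hR', rfl⟩
      exact isMaxOn_iff.1 hmax p' ⟨hp', hR'⟩
    have h3 := hW p₀ hp₀.1
    have h4 := mul_le_mul_of_nonneg_left (hp₀.2 : deficit p₀ ≤ R) hμ.le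
    have h5 : μ * deficit p₀ = μ * R := by linarith
    have h6 := mul_left_cancel₀ hμ.ne' h5
    rcases hW' p₀ hp₀.1 (by linarith) with h | h <;> linarith

end Envelope

/-! ### From supporting lines to minimal maximizers -/

section Maximizer

theorem exists_isRelabelling_fin {A S : Type*} [Fintype S] {V : A → S → ℝ} (hV : IsChannel V)
    {N : ℕ} (hN : Fintype.card S = N) :
    ∃ q : A → Fin N → ℝ, IsChannel q ∧ IsRelabelling q V := by
  let e := (Fintype.equivFinOfCardEq hN).symm
  refine ⟨fun x t => V x (e t), fun x => ⟨fun t => (hV x).1 _, ?_⟩, e, fun _ _ => rfl⟩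
  rw [Equiv.sum_comp e (V x)]
  exact (hV x).2

theorem card_pos_of_isChannel {A T : Type*} [Nonempty A] [Fintype T] {q : A → T → ℝ}
    (hq : IsChannel q) : 1 ≤ Fintype.card T := by
  obtain ⟨a⟩ := ‹Nonempty A›
  by_contra! h
  have : IsEmpty T := Fintype.card_eq_zero_iff.1 (by omega)
  have := (hq a).2
  simp at this

variable {A : Type*} [Fintype A]

/-- `IsMaximizer` competes only against alphabets `Fin m`, so the bound for q over T is a separate
hypothesis. -/
theorem isMaximizer_iff {B T : Type*} [Fintype B] [Fintype T] {p : A → ℝ} {W : A → B → ℝ}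
    {R v : ℝ} {q : A → T → ℝ} (hle : IsFeasible p R q → infoYT p W q ≤ v)
    (hle' : ∀ (m : ℕ) (q' : A → Fin m → ℝ), IsFeasible p R q' → infoYT p W q' ≤ v)
    (hex : ∃ (m : ℕ) (q' : A → Fin m → ℝ), IsFeasible p R q' ∧ infoYT p W q' = v) :
    IsMaximizer p W R q ↔ IsFeasible p R q ∧ infoYT p W q = v := by
  constructor
  · rintro ⟨hq, h⟩
    obtain ⟨m, q', hq', rfl⟩ := hex
    exact ⟨hq, le_antisymm (hle hq) (h m q' hq')⟩
  · rintro ⟨hq, rfl⟩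
    exact ⟨hq, hle'⟩

theorem isMinimalMaximizer_iff {B T : Type*} [Fintype B] [Fintype T] {p : A → ℝ}
    {W : A → B → ℝ} {R : ℝ} {q : A → T → ℝ} {N : ℕ} {P : Prop}
    (h1 : IsMaximizer p W R q → N ≤ Fintype.card T ∧ (Fintype.card T = N → P))
    (h2 : ∀ (m : ℕ) (q' : A → Fin m → ℝ), IsMaximizer p W R q' → N ≤ m)
    (hex : ∃ q' : A → Fin N → ℝ, IsMaximizer p W R q')
    (h3 : Fintype.card T = N → P → IsMaximizer p W R q) :
    IsMinimalMaximizer p W R q ↔ Fintype.card T = N ∧ P := by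
  constructor
  · rintro ⟨hq, hmin⟩
    obtain ⟨q', hq'⟩ := hex
    have h := le_antisymm (hmin N q' hq') (h1 hq).1
    exact ⟨h, (h1 hq).2 h⟩
  · rintro ⟨hT, hP⟩
    refine ⟨h3 hT hP, fun m q' hq' => ?_⟩
    rw [hT]
    exact h2 m q' hq'

variable [DecidableEq A]

theorem isChannel_hamming {β : ℝ} (hβ : β ∈ Icc 0 (1 / (Fintype.card A : ℝ))) :
    IsChannel (hamming A β) := fun x => hamming_mem_stdSimplex hβ x

theorem isChannel_timeShare {β s : ℝ} (hβ : β ∈ Icc 0 (1 / (Fintype.card A : ℝ)))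
    (hs : s ∈ Icc (0 : ℝ) 1) : IsChannel (timeShare s (hamming A β)) := by
  refine fun x => ⟨fun o => ?_, ?_⟩
  · cases o with
    | none => exact sub_nonneg.2 hs.2
    | some i => exact mul_nonneg hs.1 ((hamming_mem_stdSimplex hβ x).1 i)
  · rw [Fintype.sum_option]
    simp only [timeShare, ← Finset.mul_sum, sum_hamming]
    ring

variable [Nonempty A] {T : Type*} [Fintype T] {q : A → T → ℝ} {α β μ R v : ℝ}

/-- Minimal maximizers when the supporting line at `R` touches at the uniform distribution and
at Hamming rows, and `R` lies strictly between. -/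
theorem isMinimalMaximizer_iff_timeShare {s : ℝ} (hμ : 0 ≤ μ) (hs : s ∈ Ioo (0 : ℝ) 1)
    (hβ : β ∈ Ico 0 (1 / (Fintype.card A : ℝ)))
    (hD : 0 < Real.log (Fintype.card A) - hEnt (Fintype.card A) β)
    (hR : R = s * (Real.log (Fintype.card A) - hEnt (Fintype.card A) β))
    (hv : v = s * (Real.log (Fintype.card A) -
      hEnt (Fintype.card A) (α + (1 - (Fintype.card A : ℝ) * α) * β)))
    (hC : ∀ p ∈ stdSimplex ℝ A, deficit (outputDist p (hamming A α)) - μ * deficit p ≤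
      v - μ * R ∧ (deficit (outputDist p (hamming A α)) - μ * deficit p = v - μ * R →
        (p = uniform A ∨ ∃ i, p = hamming A β i) ∧ (0 < μ ∨ deficit p = R)))
    (hq : IsChannel q) :
    IsMinimalMaximizer (uniform A) (hamming A α) R q ↔ Fintype.card T = Fintype.card A + 1 ∧
      IsRelabelling q (timeShare s (hamming A β)) := by
  obtain ⟨q₀, hq₀, hrel₀⟩ := exists_isRelabelling_fin
    (isChannel_timeShare (A := A) ⟨hβ.1, hβ.2.le⟩ ⟨hs.1.le, hs.2.le⟩) (Fintype.card_option)
  obtain ⟨hX₀, hY₀⟩ := info_of_isRelabelling_timeShare hq₀ hrel₀ α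
  have hopt₀ : IsFeasible (uniform A) R q₀ ∧ infoYT (uniform A) (hamming A α) q₀ = v :=
    ⟨⟨hq₀, by rw [hX₀, hR]⟩, by rw [hY₀, hv]⟩
  have hle' : ∀ (m : ℕ) (q' : A → Fin m → ℝ), IsFeasible (uniform A) R q' →
      infoYT (uniform A) (hamming A α) q' ≤ v := fun m q' h => (infoYT_le_of_support hμ hC h).1
  have hiff := isMaximizer_iff (q := q) (fun h => (infoYT_le_of_support hμ hC h).1) hle'
    ⟨_, q₀, hopt₀⟩
  have hiff' := fun (m : ℕ) (q' : A → Fin m → ℝ) =>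
    isMaximizer_iff (hle' m q') hle' ⟨_, q₀, hopt₀⟩
  refine isMinimalMaximizer_iff (fun h => ?_) (fun m q' h => ?_) ⟨q₀, (hiff' _ q₀).2 hopt₀⟩
    fun _ h => hiff.2 ?_
  · obtain ⟨hf, hY⟩ := hiff.1 h
    obtain ⟨hp, hX⟩ := (infoYT_le_of_support hμ hC hf).2 hY
    exact card_le_and_isRelabelling_timeShare hq hs hβ.2 hD hp (hX.trans hR)
  · obtain ⟨hf, hY⟩ := (hiff' m q').1 h
    obtain ⟨hp, hX⟩ := (infoYT_le_of_support hμ hC hf).2 hY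
    simpa using (card_le_and_isRelabelling_timeShare hf.1 hs hβ.2 hD hp (hX.trans hR)).1
  · obtain ⟨hX, hY⟩ := info_of_isRelabelling_timeShare hq h α
    exact ⟨⟨hq, by rw [hX, hR]⟩, by rw [hY, hv]⟩

/-- Minimal maximizers when the supporting line at `R` touches at Hamming rows of rate `R`. -/
theorem isMinimalMaximizer_iff_hamming (hμ : 0 ≤ μ)
    (hβ : β ∈ Ico 0 (1 / (Fintype.card A : ℝ)))
    (hD : 0 < Real.log (Fintype.card A) - hEnt (Fintype.card A) β)
    (hR : R = Real.log (Fintype.card A) - hEnt (Fintype.card A) β)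
    (hv : v = Real.log (Fintype.card A) -
      hEnt (Fintype.card A) (α + (1 - (Fintype.card A : ℝ) * α) * β))
    (hC : ∀ p ∈ stdSimplex ℝ A, deficit (outputDist p (hamming A α)) - μ * deficit p ≤
      v - μ * R ∧ (deficit (outputDist p (hamming A α)) - μ * deficit p = v - μ * R →
        (p = uniform A ∨ ∃ i, p = hamming A β i) ∧ (0 < μ ∨ deficit p = R)))
    (hq : IsChannel q) :
    IsMinimalMaximizer (uniform A) (hamming A α) R q ↔ Fintype.card T = Fintype.card A ∧
      IsRelabelling q (hamming A β) := by
  obtain ⟨q₀, hq₀, hrel₀⟩ := exists_isRelabelling_fin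
    (isChannel_hamming (A := A) ⟨hβ.1, hβ.2.le⟩) rfl
  obtain ⟨hX₀, hY₀⟩ := info_of_isRelabelling_hamming hq₀ hrel₀ α
  have hopt₀ : IsFeasible (uniform A) R q₀ ∧ infoYT (uniform A) (hamming A α) q₀ = v :=
    ⟨⟨hq₀, by rw [hX₀, hR]⟩, by rw [hY₀, hv]⟩
  have hle' : ∀ (m : ℕ) (q' : A → Fin m → ℝ), IsFeasible (uniform A) R q' →
      infoYT (uniform A) (hamming A α) q' ≤ v := fun m q' h => (infoYT_le_of_support hμ hC h).1
  have hiff := isMaximizer_iff (q := q) (fun h => (infoYT_le_of_support hμ hC h).1) hle'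
    ⟨_, q₀, hopt₀⟩
  have hiff' := fun (m : ℕ) (q' : A → Fin m → ℝ) =>
    isMaximizer_iff (hle' m q') hle' ⟨_, q₀, hopt₀⟩
  refine isMinimalMaximizer_iff (fun h => ?_) (fun m q' h => ?_) ⟨q₀, (hiff' _ q₀).2 hopt₀⟩
    fun _ h => hiff.2 ?_
  · obtain ⟨hf, hY⟩ := hiff.1 h
    obtain ⟨hp, hX⟩ := (infoYT_le_of_support hμ hC hf).2 hY
    exact card_le_and_isRelabelling_hamming hq hβ.2 hD hp (hX.trans hR)
  · obtain ⟨hf, hY⟩ := (hiff' m q').1 h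
    obtain ⟨hp, hX⟩ := (infoYT_le_of_support hμ hC hf).2 hY
    simpa using (card_le_and_isRelabelling_hamming hf.1 hβ.2 hD hp (hX.trans hR)).1
  · obtain ⟨hX, hY⟩ := info_of_isRelabelling_hamming hq h α
    exact ⟨⟨hq, by rw [hX, hR]⟩, by rw [hY, hv]⟩

/-- At rate 0 the line through the origin bounds I(Y;T) by 0, which a constant T attains. -/
theorem isMinimalMaximizer_zero_iff (hμ : 0 ≤ μ)
    (hC : ∀ p ∈ stdSimplex ℝ A, deficit (outputDist p (hamming A α)) ≤ μ * deficit p)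
    (hq : IsChannel q) :
    IsMinimalMaximizer (uniform A) (hamming A α) 0 q ↔ Fintype.card T = 1 := by
  have hle : ∀ (m : ℕ) (q' : A → Fin m → ℝ), IsFeasible (uniform A) 0 q' →
      infoYT (uniform A) (hamming A α) q' ≤ 0 := fun m q' h => by
    have h1 := (infoYT_sub_le (fun p hp => sub_nonpos.2 (hC p hp)) h.1).1
    have h2 := mul_nonpos_of_nonneg_of_nonpos hμ h.2
    linarith
  have hmax : Fintype.card T = 1 → IsMaximizer (uniform A) (hamming A α) 0 q := by
    intro hT
    obtain ⟨t₀, ht₀⟩ := Fintype.card_eq_one_iff.1 hT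
    have hq1 : ∀ x t, q x t = 1 := fun x t => by
      rw [← (hq x).2, Finset.sum_eq_single t (fun t' _ h => absurd ((ht₀ t').trans (ht₀ t).symm) h)
        (by simp)]
    obtain ⟨h1, h2⟩ := info_eq_sum_deficit hq (P := fun _ => 1) (s := fun _ => uniform A)
      (fun a t => by rw [hq1]; ring) (fun _ _ => uniform_mem_stdSimplex.2) α
    simp only [outputDist_uniform_hamming, deficit_uniform, mul_zero, Finset.sum_const_zero]
      at h1 h2
    exact ⟨⟨hq, h1.le⟩, fun m q' hq' => (hle m q' hq').trans h2.ge⟩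
  have hch : IsChannel fun (_ : A) (_ : Fin 1) => (1 : ℝ) := fun _ => ⟨fun _ => zero_le_one, by simp⟩
  constructor
  · rintro ⟨_, hmin⟩
    refine le_antisymm (hmin 1 (fun _ _ => 1) ?_) (card_pos_of_isChannel hq)
    obtain ⟨h1, h2⟩ := info_eq_sum_deficit hch (P := fun _ => 1) (s := fun _ => uniform A)
      (fun a t => by ring) (fun _ _ => uniform_mem_stdSimplex.2) α
    simp only [outputDist_uniform_hamming, deficit_uniform, mul_zero, Finset.sum_const_zero]
      at h1 h2
    exact ⟨⟨hch, h1.le⟩, fun m q' hq' => (hle m q' hq').trans h2.ge⟩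
  · intro hT
    refine ⟨hmax hT, fun m q' hq' => ?_⟩
    rw [hT]
    simpa using card_pos_of_isChannel hq'.1.1

end Maximizer

end IB

/-! ### The theorem -/

theorem mainTheorem4 {A : Type*} [Fintype A] [DecidableEq A] (n : ℕ) (hn : 3 ≤ n)
    (hA : Fintype.card A = n) (α : ℝ) (hα0 : 0 < α) (hα1 : α < 1 / ((n : ℝ) - 1))
    (hαn : α ≠ 1 / (n : ℝ)) :
    ∃ Rc : ℝ, IsLeast (IB.touchingSet (IB.hamming A α)) Rc ∧ Rc < Real.log n ∧
      ∀ (R : ℝ) (T : Type*) [Fintype T] (q : A → T → ℝ), IB.IsChannel q →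
        (R = 0 →
          (IB.IsMinimalMaximizer (IB.uniform A) (IB.hamming A α) R q ↔
            Fintype.card T = 1)) ∧
        (0 < R → R < Rc →
          (IB.IsMinimalMaximizer (IB.uniform A) (IB.hamming A α) R q ↔
            Fintype.card T = n + 1 ∧
              IB.IsRelabelling q
                (IB.timeShare (R / Rc) (IB.hamming A (IB.hInv n (Real.log n - Rc)))))) ∧
        (Rc ≤ R → R ≤ Real.log n →
          (IB.IsMinimalMaximizer (IB.uniform A) (IB.hamming A α) R q ↔
            Fintype.card T = n ∧
              IB.IsRelabelling q (IB.hamming A (IB.hInv n (Real.log n - R))))) := by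
  obtain ⟨bc, hbc, μc, hμc, heq, hC, hleft⟩ := IB.exists_critical_deficit hn hA hα0 hα1 hαn
  have hbcI : bc ∈ Set.Icc 0 (1 / (n : ℝ)) := ⟨hbc.1.le, hbc.2.le⟩
  have hne : Nonempty A := Fintype.card_pos_iff.1 (by omega)
  obtain ⟨a⟩ := id hne
  have hmono := IB.strictMonoOn_hEnt (n := n) (by omega)
  have h1n : 1 / (n : ℝ) ∈ Set.Icc 0 (1 / (n : ℝ)) := ⟨by positivity, le_rfl⟩
  have hD : ∀ b ∈ Set.Ico 0 (1 / (n : ℝ)), 0 < Real.log n - IB.hEnt n b := fun b hb => by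
    have := hmono ⟨hb.1, hb.2.le⟩ h1n hb.2
    rw [IB.hEnt_one_div (by omega)] at this
    linarith
  have hDc := hD bc ⟨hbc.1.le, hbc.2⟩
  have hEc : 0 < IB.hEnt n bc := by
    rw [← IB.hEnt_zero n]
    exact hmono ⟨le_rfl, h1n.1⟩ hbcI hbc.1
  have hdef : ∀ b i, IB.deficit (IB.hamming A b i) = Real.log n - IB.hEnt n b := fun b i => by
    rw [IB.deficit_hamming, hA]
  -- The critical line passes through the origin, so it supports with v = μc R at every R in (0,
  -- R_c].
  have hline : ∀ R, ∀ p ∈ stdSimplex ℝ A,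
      IB.deficit (IB.outputDist p (IB.hamming A α)) - μc * IB.deficit p ≤ μc * R - μc * R ∧
      (IB.deficit (IB.outputDist p (IB.hamming A α)) - μc * IB.deficit p = μc * R - μc * R →
        (p = IB.uniform A ∨ ∃ i, p = IB.hamming A bc i) ∧ (0 < μc ∨ IB.deficit p = R)) := by
    intro R p hp
    rw [sub_self, sub_nonpos, sub_eq_zero]
    exact ⟨(hC p hp).1, fun h => ⟨(hC p hp).2 h, Or.inl hμc⟩⟩
  refine ⟨Real.log n - IB.hEnt n bc, ?_, by linarith, fun R T _ q hq => ⟨?_, ?_, ?_⟩⟩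
  · rw [← hdef bc a]
    refine IB.isLeast_touchingSet hμc (fun p hp => (hC p hp).1)
      (IB.outputDist_uniform_hamming α) (IB.hamming_mem_stdSimplex (by rwa [hA]) a) ?_ ?_ ?_ ?_
    · rwa [hdef]
    · rw [hdef, hA]
      linarith
    · rw [IB.outputDist_hamming_hamming, hdef, hdef, hA, heq]
    · intro p hp h
      rcases (hC p hp).2 h with rfl | ⟨i, rfl⟩
      · exact Or.inl IB.deficit_uniform
      · exact Or.inr (by rw [hdef, hdef])
  · rintro rfl
    exact IB.isMinimalMaximizer_zero_iff hμc.le (fun p hp => (hC p hp).1) hq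
  · intro hR0 hRc
    rw [sub_sub_cancel, IB.hInv_hEnt (by omega) hbcI]
    subst hA
    refine IB.isMinimalMaximizer_iff_timeShare hμc.le
      ⟨div_pos hR0 hDc, (div_lt_one hDc).2 hRc⟩ ⟨hbc.1.le, hbc.2⟩ hDc
      (div_mul_cancel₀ R hDc.ne').symm (v := μc * R) ?_ (hline R) hq
    rw [heq]
    field_simp
  · intro hRc hRn
    obtain ⟨β, hβ, hβR⟩ := IB.exists_hEnt_eq (n := n) (by omega) (sub_nonneg.2 hRn)
      (by linarith : Real.log n - R ≤ Real.log n)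
    have hR : R = Real.log n - IB.hEnt n β := by linarith
    rw [← hβR, IB.hInv_hEnt (by omega) hβ]
    -- Larger rates mean smaller crossovers. At β = bc the critical line is used, below it the
    -- tangent at β.
    have hle : β ≤ bc := (hmono.le_iff_le hβ hbcI).1 (by linarith)
    have hβ' : β ∈ Set.Ico 0 (1 / (n : ℝ)) := ⟨hβ.1, hle.trans_lt hbc.2⟩
    rcases hle.eq_or_lt with rfl | hlt
    · subst hA
      refine IB.isMinimalMaximizer_iff_hamming hμc.le hβ' hDc hR (v := μc * R) ?_ (hline R) hq
      rw [heq, hR]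
    · obtain ⟨μ, hμ, hk⟩ := hleft β ⟨hβ.1, hlt⟩
      subst hA
      refine IB.isMinimalMaximizer_iff_hamming hμ hβ' (hD β hβ') hR rfl (fun p hp => ?_) hq
      obtain ⟨h1, h2⟩ := hk p hp
      rw [← hR] at h1 h2
      refine ⟨h1, fun h => ?_⟩
      obtain ⟨i, rfl⟩ := h2 h
      exact ⟨Or.inr ⟨i, rfl⟩, Or.inr (by rw [hdef, hR])⟩
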